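/- Let $k$ be a field and let $p$ be a prime. An algebra $A$ over a field $F$ (associative, with unit) is called separable over $F$ if it is finite-dimensional and $\overline{F}\otimes_F A$ is semisimple, where $\overline F$ is the algebraic closure of $F$. Let $B$ be a separable algebra over the field $k((t))$ of formal Laurent series, let $\eta_t$ be a $k((t))$-algebra automorphism of $B$, and let $B[y;\eta_t]$ be the skew polynomial ring, in which $yb=\eta_t(b)y$ for $b\in B$. Let $u\in B^\times$ be a unit with $\eta_t(u)=u$ and $\eta_t^p(b)=ubu^{-1}$ for all $b\in B$, so that $B*C_p=B[y;\eta_t]/\langle y^p-u\rangle$ is a crossed product of the cyclic group $C_p$ of order $p$ over $B$. Then: (1) There is a skew polynomial $q_t(y)\in B[y;\eta_t]$ of degree at most $1$ such that the quotient $B[y;\eta_t]/\langle y^p-u+q_t(y)\rangle$ by the two-sided ideal generated by $y^p-u+q_t(y)$ is separable over $k((t))$ and is, like $B*C_p$, a free left $B$-module with basis the classes of $1,y,\dots,y^{p-1}$. (2) If moreover $B=k((t))\otimes_{k[[t]]}[B]$ for some $k[[t]]$-algebra $[B]$, then $q_t(y)$ in (1) can be chosen with all its coefficients in $t[B]$,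 that is, in the image of $t[B]$ under $[B]\to B$, $b\mapsto 1\otimes b$. -/

import Mathlib

open scoped TensorProduct

noncomputable section

/-- An algebra `A` over a field `F` is separable if it is finite-dimensional and its scalar
extension to the algebraic closure of `F` is a semisimple ring. -/
def IsSeparableAlgebra (F : Type*) [Field F] (A : Type*) [Ring A] [Algebra F A] : Prop :=
  Module.Finite F A ∧ IsSemisimpleRing (AlgebraicClosure F ⊗[F] A)

section Twisted

variable {F B : Type*} [Field F] [Ring B] [Algebra F B]

/-- The algebra `B`, remembering an automorphism `η` of it. It is given the action of the monoid
`(ℕ, +)` (written multiplicatively) in which `n` acts as `η ^ n`. -/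
def Twisted (_η : B ≃ₐ[F] B) : Type _ := B

variable (η : B ≃ₐ[F] B)

instance Twisted.instRing : Ring (Twisted η) := inferInstanceAs (Ring B)

instance Twisted.instAlgebra : Algebra F (Twisted η) := inferInstanceAs (Algebra F B)

/-- The identity map of `B`, as an isomorphism from `B` to `Twisted η`. -/
def Twisted.of : B ≃ₐ[F] Twisted η := AlgEquiv.refl

instance Twisted.instMulSemiringAction : MulSemiringAction (Multiplicative ℕ) (Twisted η) where
  smul n b := Twisted.of η ((η ^ n.toAdd) ((Twisted.of η).symm b))
  one_smul _ := rfl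
  mul_smul m n b := by
    change Twisted.of η ((η ^ (m.toAdd + n.toAdd)) _) = _
    rw [pow_add]
    rfl
  smul_zero n := map_zero (η ^ n.toAdd)
  smul_add n := map_add (η ^ n.toAdd)
  smul_one n := map_one (η ^ n.toAdd)
  smul_mul n := map_mul (η ^ n.toAdd)

instance Twisted.instSMulCommClass : SMulCommClass (Multiplicative ℕ) F (Twisted η) where
  smul_comm n c b := map_smul (η ^ n.toAdd) c ((Twisted.of η).symm b)

/-- The skew polynomial ring `B[y; η]`, in which `y b = η(b) y`. -/
abbrev SkewPoly : Type _ := SkewPolynomial (Twisted η)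

/-- The quotient `B[y; η] / ⟨f⟩` by the two-sided ideal generated by `f`. -/
abbrev SkewQuotient {η : B ≃ₐ[F] B} (f : SkewPoly η) : Type _ :=
  (TwoSidedIdeal.span {f}).ringCon.Quotient

/-- In `B[y; η] / ⟨f⟩` the residue classes of `1, y, …, y ^ (p - 1)` form a basis of the quotient
as a left `B`-module. -/
def IsFreeOnPowers {η : B ≃ₐ[F] B} (p : ℕ) (f : SkewPoly η) : Prop :=
  ∀ x : SkewQuotient f, ∃! c : Fin p → B,
    x = (TwoSidedIdeal.span {f}).ringCon.mk'
      (∑ i : Fin p, SkewPolynomial.C (Twisted.of η (c i)) * SkewPolynomial.X ^ (i : ℕ))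

end Twisted

end

/-! ### Splitting data and their formal consequences. -/

noncomputable section

/-! The polynomial used is `y ^ p - u + c y` with `c = t ^ N • (u * d)`, where `d` is built from the
action of `η` on the center `Z` of `B`. If `p` is invertible, `d = 0` works: the crossed product is
already separable. If `p = 0`, then `η ^ p` is inner, so `η` acts on `Z` with `p`-th power one, and
an `η`-fixed central idempotent `ε` splits `B` in two (`exists_orbitSum_splitting`). On the part `ε
= 1`, some central `z` has trace `1`. On the part `ε = 0`, `η` fixes the center, so by
Skolem–Noether it is inner, implemented by a unit `d`; elsewhere `d = 0`.

Semisimplicity of the quotient is a Maschke argument (`SplittingData.isSemisimpleRing`): a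
`B`-linear projection onto a left ideal is averaged into one that also commutes with `y`. Where `ε =
1`, the relation is `y ^ p = u`, and `z` supplies the weights that `1 / p` would give. Where `ε =
0`, the element `W = d y` commutes with `B` and satisfies `W ^ p = a (1 - W)` for a central unit
`a`. Since `p = 0` there, the derivative of `W ^ p + a W - a` is the unit `a`, and the separability
idempotent of this polynomial does the averaging. Splitting data survive extension to the algebraic
closure, so the same argument gives separability.

Freeness holds because `y ^ p - u + c y` is a monic normal element. Finally, `d` may be multiplied
by any power of `t` (`SplittingData.scale`), and a high power moves `c` into `t[B]`. -/

/-- The sum of the first `p` iterates of `σ` applied to `z`. -/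
def orbitSum {S : Type*} [Ring S] (σ : S →+* S) (p : ℕ) (z : S) : S :=
  ∑ i ∈ Finset.range p, (σ ^ i) z

/-- A central element `z` whose orbit sum `ε` under `σ` is idempotent, together with an element `d`
that is a unit with inverse `d'` on the complementary component, and that implements the inverse
of `σ` there. The number `p` vanishes on that component. -/
structure SplittingData {S : Type*} [Ring S] (σ : S →+* S) (p : ℕ) (z d d' : S) : Prop where
  comm (i : ℕ) (s : S) : (σ ^ i) z * s = s * (σ ^ i) z
  twist (s : S) : d * σ s = s * d
  map_d : σ d = d
  d_mul : d * d' + orbitSum σ p z = 1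
  mul_d : d' * d + orbitSum σ p z = 1
  sum_z : orbitSum σ p z * z = z
  sum_d : orbitSum σ p z * d = 0
  sum_d' : orbitSum σ p z * d' = 0
  cast_d' : (p : S) * d' = 0

namespace SplittingData

variable {S : Type*} [Ring S] {σ : S →+* S} {p : ℕ} {z d d' : S}

theorem sum_comm (D : SplittingData σ p z d d') (s : S) :
    orbitSum σ p z * s = s * orbitSum σ p z := by
  simp only [orbitSum, Finset.sum_mul, Finset.mul_sum, D.comm]

/-- Multiply `twist` by `d'` on both sides: on the complement of `ε` this inverts `d`, and on `ε`
both sides vanish. -/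
theorem twist' (D : SplittingData σ p z d d') (s : S) : σ s * d' = d' * s := by
  have h1 : d' * (d * σ s) * d' = d' * (s * d) * d' := by rw [D.twist]
  have h2 : d' * d = 1 - orbitSum σ p z := eq_sub_of_add_eq D.mul_d
  have h3 : d * d' = 1 - orbitSum σ p z := eq_sub_of_add_eq D.d_mul
  have h4 : d' * (d * σ s) * d' = σ s * d' := by
    rw [← mul_assoc, h2, sub_mul, one_mul, D.sum_comm, sub_mul, mul_assoc _ _ d', D.sum_d']
    simp
  have h5 : d' * (s * d) * d' = d' * s := by
    rw [mul_assoc, mul_assoc s, h3, mul_sub, mul_one, ← D.sum_comm, mul_sub, ← mul_assoc d',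
      ← D.sum_comm, D.sum_d']
    simp
  rw [← h4, h1, h5]

theorem z_mul_d (D : SplittingData σ p z d d') : z * d = 0 := by
  rw [← D.sum_z, mul_assoc, D.sum_comm, mul_assoc, ← D.sum_comm, D.sum_d, mul_zero]

theorem pow_twist' (D : SplittingData σ p z d d') (n : ℕ) (s : S) :
    (σ ^ n) s * d' ^ n = d' ^ n * s := by
  induction n generalizing s with
  | zero => simp
  | succ n ih =>
    rw [pow_succ, pow_succ d', RingHom.mul_def, RingHom.comp_apply, ← mul_assoc, ih, mul_assoc,
      D.twist', mul_assoc]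

theorem d_mul_eq (D : SplittingData σ p z d d') : d * d' = 1 - orbitSum σ p z :=
  eq_sub_of_add_eq D.d_mul

theorem mul_d_eq (D : SplittingData σ p z d d') : d' * d = 1 - orbitSum σ p z :=
  eq_sub_of_add_eq D.mul_d

theorem d'_pow_mul_pow (D : SplittingData σ p z d d') (n : ℕ) :
    d' ^ (n + 1) * d ^ (n + 1) = 1 - orbitSum σ p z := by
  induction n with
  | zero => simpa using D.mul_d_eq
  | succ n ih =>
    rw [pow_succ, pow_succ' d, mul_assoc, ← mul_assoc d', D.mul_d_eq, sub_mul, one_mul,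
      pow_succ' d n, ← mul_assoc _ d, D.sum_d, zero_mul, sub_zero, ← pow_succ', ih]

theorem map_d_mul (D : SplittingData σ p z d d') : σ (d * d') = d * d' := by
  rw [map_mul, D.map_d, D.twist, D.mul_d_eq, D.d_mul_eq]

theorem d_mul_comm (D : SplittingData σ p z d d') (s : S) : d * d' * s = s * (d * d') := by
  rw [D.d_mul_eq, sub_mul, mul_sub, one_mul, mul_one, D.sum_comm]

theorem d_mul_d' (D : SplittingData σ p z d d') : d * d' * d' = d' := by
  rw [D.d_mul_eq, sub_mul, D.sum_d', one_mul, sub_zero]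

theorem d_mul_sq (D : SplittingData σ p z d d') : d * d' * (d * d') = d * d' := by
  rw [← D.d_mul_comm, mul_assoc d d' (d * d'), ← D.d_mul_comm, D.d_mul_d']

/-- This freedom, applied with `a` a power of `t`, is what makes the integrality claim possible. -/
theorem scale (D : SplittingData σ p z d d') {a a' : S} (ha : ∀ s, a * s = s * a)
    (ha' : ∀ s, a' * s = s * a') (hσ : σ a = a) (haa' : a * a' = 1) :
    SplittingData σ p z (a * d) (a' * d') where
  comm := D.comm
  twist s := by rw [mul_assoc, D.twist, ← mul_assoc, ha, mul_assoc]
  map_d := by rw [map_mul, hσ, D.map_d]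
  d_mul := by
    rw [mul_assoc, ← mul_assoc d, ← ha', mul_assoc, ← mul_assoc, haa', one_mul, D.d_mul]
  mul_d := by
    rw [mul_assoc, ← mul_assoc d', ← ha, mul_assoc, ← mul_assoc, ha', haa', one_mul, D.mul_d]
  sum_z := D.sum_z
  sum_d := by rw [← mul_assoc, ← ha, mul_assoc, D.sum_d, mul_zero]
  sum_d' := by rw [← mul_assoc, ← ha', mul_assoc, D.sum_d', mul_zero]
  cast_d' := by rw [← mul_assoc, ← ha', mul_assoc, D.cast_d', mul_zero]

/-- Transports data from a product of matrix algebras and along base change. Since `j` need not be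
surjective, centrality and twisting against all of `S'` must be supplied. -/
theorem map {S' : Type*} [Ring S'] {τ : S' →+* S'} (D : SplittingData σ p z d d') (j : S →+* S')
    (hj : ∀ s, τ (j s) = j (σ s)) (hz : ∀ i s, j ((σ ^ i) z) * s = s * j ((σ ^ i) z))
    (hd : ∀ s, j d * τ s = s * j d) : SplittingData τ p (j z) (j d) (j d') := by
  have hpow (i : ℕ) (s : S) : (τ ^ i) (j s) = j ((σ ^ i) s) := by
    induction i generalizing s with
    | zero => simp
    | succ i ih =>
      rw [pow_succ, pow_succ, RingHom.mul_def, RingHom.mul_def, RingHom.comp_apply,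
        RingHom.comp_apply, hj, ih]
  have hsum : orbitSum τ p (j z) = j (orbitSum σ p z) := by simp [orbitSum, hpow]
  constructor
  · intro i s
    rw [hpow, hz]
  · exact hd
  · rw [hj, D.map_d]
  · rw [hsum, ← map_mul, ← map_add, D.d_mul, map_one]
  · rw [hsum, ← map_mul, ← map_add, D.mul_d, map_one]
  · rw [hsum, ← map_mul, D.sum_z]
  · rw [hsum, ← map_mul, D.sum_d, map_zero]
  · rw [hsum, ← map_mul, D.sum_d', map_zero]
  · rw [← map_natCast j, ← map_mul, D.cast_d', map_zero]

/-! ### Averaging operators on the two components. -/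

section Averaging

variable {Λ : Type*} [Ring Λ] (ι : S →+* Λ) (σ p z d d') (u : Sˣ) (Y : Λ)

/-- The contribution of the component on which `z` has orbit sum one to the averaging operator. -/
def averageOrbit (φ : Λ) : Λ :=
  ∑ i ∈ Finset.range p, ι ((σ ^ i) z * (↑u⁻¹ : S)) * Y ^ i * φ * Y ^ (p - i)

/-- The contribution of the component on which `d` is a unit to the averaging operator. -/
def averageInner (φ : Λ) : Λ :=
  ι (d * d') * φ + ι ((↑u⁻¹ : S) * d' ^ p) *
    ∑ i ∈ Finset.range p, (ι d * Y) ^ i * φ * (ι d * Y) ^ (p - 1 - i)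

/-- The averaging operator turning `S`-linear maps into maps that also commute with `Y`. -/
def average (φ : Λ) : Λ := averageOrbit σ p z ι u Y φ + averageInner p d d' ι u Y φ

variable {σ p z d d' ι u Y}

theorem pow_mul_ι (hY : ∀ s, Y * ι s = ι (σ s) * Y) (n : ℕ) (s : S) :
    Y ^ n * ι s = ι ((σ ^ n) s) * Y ^ n := by
  induction n generalizing s with
  | zero => simp
  | succ n ih =>
    rw [pow_succ, mul_assoc, hY, ← mul_assoc, ih, pow_succ σ, RingHom.mul_def, RingHom.comp_apply,
      mul_assoc]

theorem map_inv (hu : σ u = u) : σ (↑u⁻¹ : S) = (↑u⁻¹ : S) := by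
  have h := congrArg σ u.inv_mul
  rw [map_mul, hu, map_one] at h
  rw [← mul_one (σ _), ← u.mul_inv, ← mul_assoc, h, one_mul]

section Orbit

variable (D : SplittingData σ p z d d') (hu : σ u = u)
  (hσ : ∀ s, (σ ^ p) s = u * s * (↑u⁻¹ : S)) (hY : ∀ s, Y * ι s = ι (σ s) * Y)
  (hYp : Y ^ p = ι u - ι (u * d) * Y)

-- Passing `s` leftwards through all `p` factors `Y` turns it into `u * s * u⁻¹`, which the weight
-- `u⁻¹` undoes.
include D hσ hY in
theorem averageOrbit_commute_ι {φ : Λ} (hφ : ∀ s, φ * ι s = ι s * φ) (s : S) :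
    averageOrbit σ p z ι u Y φ * ι s = ι s * averageOrbit σ p z ι u Y φ := by
  simp only [averageOrbit, Finset.sum_mul, Finset.mul_sum]
  refine Finset.sum_congr rfl fun i hi => ?_
  have hip : i + (p - i) = p := by have := Finset.mem_range.1 hi; omega
  have h : (σ ^ i) ((σ ^ (p - i)) s) = u * s * (↑u⁻¹ : S) := by
    rw [← hσ, ← RingHom.comp_apply, ← RingHom.mul_def, ← pow_add, hip]
  rw [mul_assoc, pow_mul_ι hY, ← mul_assoc, mul_assoc _ φ, hφ, ← mul_assoc, mul_assoc _ (Y ^ i),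
    pow_mul_ι hY, h, ← mul_assoc, ← map_mul]
  have h2 : (σ ^ i) z * (↑u⁻¹ : S) * (u * s * (↑u⁻¹ : S)) = s * ((σ ^ i) z * (↑u⁻¹ : S)) := by
    simp only [← mul_assoc, Units.inv_mul_cancel_right]
    rw [D.comm]
  rw [h2, map_mul]
  simp only [mul_assoc]

include D hYp in
theorem ι_z_mul_pow : ι (z * (↑u⁻¹ : S)) * Y ^ p = ι z := by
  rw [hYp, mul_sub, ← mul_assoc, ← map_mul, ← map_mul, mul_assoc, mul_assoc, Units.inv_mul,
    Units.inv_mul_cancel_left, D.z_mul_d]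
  simp

-- Moving `Y` from one side to the other shifts the summation index by one. The wrap-around term
-- agrees with the initial one because `σ ^ p` fixes `z` and, as `z * d = 0`, `Y ^ p` acts as `u`
-- next to `z`.
include D hu hσ hY hYp in
theorem averageOrbit_commute {φ : Λ} (hφ : ∀ s, φ * ι s = ι s * φ) :
    averageOrbit σ p z ι u Y φ * Y = Y * averageOrbit σ p z ι u Y φ := by
  set g : ℕ → Λ := fun i => ι ((σ ^ i) z * (↑u⁻¹ : S)) * Y ^ i * φ * Y ^ (p - i + 1) with hg
  have h1 : averageOrbit σ p z ι u Y φ * Y = ∑ i ∈ Finset.range p, g i := by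
    simp only [averageOrbit, Finset.sum_mul, hg]
    exact Finset.sum_congr rfl fun i _ => by rw [pow_succ, mul_assoc _ _ Y]
  have h2 : Y * averageOrbit σ p z ι u Y φ = ∑ i ∈ Finset.range p, g (i + 1) := by
    simp only [averageOrbit, Finset.mul_sum, hg]
    refine Finset.sum_congr rfl fun i hi => ?_
    have hip : p - (i + 1) + 1 = p - i := by have := Finset.mem_range.1 hi; omega
    rw [hip, ← mul_assoc, ← mul_assoc, ← mul_assoc, hY, map_mul, map_inv hu, pow_succ' σ,
      RingHom.mul_def, RingHom.comp_apply, pow_succ' Y, ← mul_assoc]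
  have hz : (σ ^ p) z = z := by
    have := D.comm 0
    simp only [pow_zero, RingHom.one_def, RingHom.id_apply] at this
    rw [hσ, ← this, mul_assoc, Units.mul_inv, mul_one]
  have h3 : g p = g 0 := by
    simp only [hg, hz, pow_zero, Nat.sub_self, Nat.sub_zero, RingHom.one_def, RingHom.id_apply,
      mul_one, zero_add, pow_one]
    rw [ι_z_mul_pow D hYp, pow_succ, ← mul_assoc, ← hφ, ← hφ, mul_assoc φ _ (Y ^ p),
      ι_z_mul_pow D hYp]
  rw [h1, h2]
  have h4 := (Finset.sum_range_succ g p).symm.trans (Finset.sum_range_succ' g p)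
  rw [h3] at h4
  exact add_right_cancel h4

include D hYp in
theorem averageOrbit_one : averageOrbit σ p z ι u Y 1 = ι (orbitSum σ p z) := by
  have hd : orbitSum σ p z * (↑u⁻¹ : S) * (u * d) = 0 := by
    rw [mul_assoc, Units.inv_mul_cancel_left, D.sum_d]
  have : averageOrbit σ p z ι u Y 1 = ι (orbitSum σ p z * (↑u⁻¹ : S)) * Y ^ p := by
    simp only [averageOrbit, orbitSum, Finset.sum_mul, _root_.map_sum, mul_one]
    refine Finset.sum_congr rfl fun i hi => ?_
    have hip : i + (p - i) = p := by have := Finset.mem_range.1 hi; omega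
    rw [mul_assoc, ← pow_add, hip]
  rw [this, hYp, mul_sub, ← mul_assoc, ← map_mul, ← map_mul, hd, Units.inv_mul_cancel_right]
  simp

end Orbit

section Inner

variable (D : SplittingData σ p z d d') (hp : p ≠ 0)
  (hσ : ∀ s, (σ ^ p) s = u * s * (↑u⁻¹ : S)) (hY : ∀ s, Y * ι s = ι (σ s) * Y)
  (hYp : Y ^ p = ι u - ι (u * d) * Y)

-- Conjugation by `u` and by `d' ^ p` both express `σ ^ p`, so they cancel. This element is the
-- inverse of the constant `a` in the equation of `W = d Y`.
include D hσ in
theorem inv_mul_pow_comm (s : S) : (↑u⁻¹ : S) * d' ^ p * s = s * ((↑u⁻¹ : S) * d' ^ p) := by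
  rw [mul_assoc, ← D.pow_twist', hσ]
  simp only [← mul_assoc, Units.inv_mul, one_mul]

include D hY in
theorem ι_d_mul_commute (s : S) : ι d * Y * ι s = ι s * (ι d * Y) := by
  rw [mul_assoc, hY, ← mul_assoc, ← map_mul, D.twist, map_mul, mul_assoc]

include D hY in
theorem ι_d_mul_pow_commute (n : ℕ) (s : S) :
    (ι d * Y) ^ n * ι s = ι s * (ι d * Y) ^ n :=
  (show Commute (ι d * Y) (ι s) from ι_d_mul_commute D hY s).pow_left n

-- The equation `W ^ p = a (1 - W)`, divided by `a`: as `σ d = d`, the factors of `W = d Y` commute,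
-- so `W ^ p = d ^ p * Y ^ p`.
include D hp hY hYp in
theorem ι_inv_mul_pow :
    ι ((↑u⁻¹ : S) * d' ^ p) * (ι d * Y) ^ p = ι (d * d') * (1 - ι d * Y) := by
  have hc : Commute (ι d) Y := by
    change ι d * Y = Y * ι d
    rw [hY, D.map_d]
  obtain ⟨n, rfl⟩ := Nat.exists_eq_succ_of_ne_zero hp
  have hd : (↑u⁻¹ : S) * d' ^ (n + 1) * d ^ (n + 1) * u = d * d' := by
    rw [mul_assoc _ (d' ^ _), D.d'_pow_mul_pow, ← D.d_mul_eq, ← D.d_mul_comm, mul_assoc,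
      Units.inv_mul, mul_one]
  rw [hc.mul_pow, hYp, ← mul_assoc, ← map_pow, ← map_mul, mul_sub, ← map_mul, hd, ← mul_assoc,
    ← map_mul, ← mul_assoc, hd, map_mul ι _ d, mul_assoc, mul_sub, mul_one]

include D hσ hY in
theorem averageInner_commute_ι {φ : Λ} (hφ : ∀ s, φ * ι s = ι s * φ) (s : S) :
    averageInner p d d' ι u Y φ * ι s = ι s * averageInner p d d' ι u Y φ := by
  rw [averageInner, add_mul, mul_add]
  congr 1
  · rw [mul_assoc, hφ, ← mul_assoc, ← mul_assoc, ← map_mul, ← map_mul, D.d_mul_comm]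
  · rw [← mul_assoc, ← map_mul, ← inv_mul_pow_comm D hσ, map_mul _ _ s, mul_assoc, mul_assoc]
    congr 1
    rw [Finset.sum_mul, Finset.mul_sum]
    refine Finset.sum_congr rfl fun i _ => ?_
    rw [mul_assoc, ι_d_mul_pow_commute D hY, ← mul_assoc, mul_assoc _ φ, hφ, ← mul_assoc,
      ι_d_mul_pow_commute D hY]
    simp only [mul_assoc]

theorem sum_pow_mul_pow_commutator (W φ : Λ) (p : ℕ) :
    (∑ i ∈ Finset.range p, W ^ i * φ * W ^ (p - 1 - i)) * W + W ^ p * φ =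
      W * (∑ i ∈ Finset.range p, W ^ i * φ * W ^ (p - 1 - i)) + φ * W ^ p := by
  set h : ℕ → Λ := fun i => W ^ i * φ * W ^ (p - i) with hh
  have h1 : (∑ i ∈ Finset.range p, W ^ i * φ * W ^ (p - 1 - i)) * W =
      ∑ i ∈ Finset.range p, h i := by
    rw [Finset.sum_mul]
    refine Finset.sum_congr rfl fun i hi => ?_
    have hip : p - i = p - 1 - i + 1 := by have := Finset.mem_range.1 hi; omega
    simp only [hh, hip, pow_succ, mul_assoc]
  have h2 : W * (∑ i ∈ Finset.range p, W ^ i * φ * W ^ (p - 1 - i)) =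
      ∑ i ∈ Finset.range p, h (i + 1) := by
    rw [Finset.mul_sum]
    refine Finset.sum_congr rfl fun i hi => ?_
    have hip : p - (i + 1) = p - 1 - i := by omega
    simp only [hh, hip, pow_succ', mul_assoc]
  have h4 := (Finset.sum_range_succ h p).symm.trans (Finset.sum_range_succ' h p)
  rw [h1, h2]
  simpa [hh] using h4

-- With `f(W) = W ^ p + a W - a`, the operator is the difference quotient of `f`, namely `∑ W ^ i ⊗
-- W ^ (p - 1 - i) + a`, divided by `a = f'(W)`. The commutator with `W` telescopes to a difference
-- of values of `f`, hence to zero.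
include D hp hY hYp in
theorem averageInner_commute_ι_d_mul {φ : Λ} (hφ : ∀ s, φ * ι s = ι s * φ) :
    averageInner p d d' ι u Y φ * (ι d * Y) = ι d * Y * averageInner p d d' ι u Y φ := by
  have hW := ι_d_mul_commute D hY
  have hWp := ι_inv_mul_pow D hp hY hYp
  have hG := sum_pow_mul_pow_commutator (ι d * Y) φ p
  rw [averageInner]
  set W := ι d * Y
  set G := ∑ i ∈ Finset.range p, W ^ i * φ * W ^ (p - 1 - i)
  set a := (↑u⁻¹ : S) * d' ^ p
  set e := d * d'
  have h1 : ι a * (G * W) = ι a * (W * G) + ι e * (W * φ) - ι e * (φ * W) := by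
    have h2 : ι a * (φ * W ^ p) = ι e * (φ * (1 - W)) := by
      rw [← mul_assoc, ← hφ, mul_assoc, hWp, ← mul_assoc, hφ, mul_assoc]
    have h3 : ι a * (W ^ p * φ) = ι e * ((1 - W) * φ) := by
      rw [← mul_assoc, hWp, mul_assoc]
    rw [eq_sub_of_add_eq hG, mul_sub, mul_add, h2, h3]
    noncomm_ring
  rw [add_mul, mul_add, mul_assoc, mul_assoc, h1, ← mul_assoc W, hW, ← mul_assoc W, hW]
  noncomm_ring

-- On the complementary component `Y` is `d'` times `W`, and the operator lives on that component,
-- so commuting with `ι` and `W` suffices.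
include D hp hσ hY hYp in
theorem averageInner_commute {φ : Λ} (hφ : ∀ s, φ * ι s = ι s * φ) :
    averageInner p d d' ι u Y φ * Y = Y * averageInner p d d' ι u Y φ := by
  have h1 := averageInner_commute_ι D hσ hY hφ
  have h2 := averageInner_commute_ι_d_mul D hp hY hYp hφ
  have h3 : ι (d * d') * averageInner p d d' ι u Y φ = averageInner p d d' ι u Y φ := by
    obtain ⟨n, rfl⟩ := Nat.exists_eq_succ_of_ne_zero hp
    rw [averageInner, mul_add, ← mul_assoc, ← mul_assoc, ← map_mul, ← map_mul, D.d_mul_sq,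
      ← mul_assoc (d * d'), D.d_mul_comm, mul_assoc _ (d * d'), pow_succ', ← mul_assoc (d * d'),
      D.d_mul_d']
  have h4 : ι d' * (ι d * Y) = ι (d * d') * Y := by
    rw [← mul_assoc, ← map_mul, D.mul_d_eq, D.d_mul_eq]
  set T := averageInner p d d' ι u Y φ
  calc T * Y = T * ι (d * d') * Y := by rw [h1, h3]
    _ = T * (ι d' * (ι d * Y)) := by rw [h4, mul_assoc]
    _ = ι d' * (ι d * Y) * T := by rw [← mul_assoc, h1, mul_assoc, h2, ← mul_assoc]
    _ = Y * (ι (d * d') * T) := by rw [h4, ← mul_assoc, hY, D.map_d_mul]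
    _ = Y * T := by rw [h3]

include D hp in
theorem averageInner_one : averageInner p d d' ι u Y 1 = ι (d * d') := by
  -- The sum contributes `p * W ^ (p - 1)`, which dies because `p` annihilates `d'`.
  have h1 : (↑u⁻¹ : S) * d' ^ p * (p : S) = 0 := by
    obtain ⟨n, rfl⟩ := Nat.exists_eq_succ_of_ne_zero hp
    rw [mul_assoc, ← (Nat.cast_commute _ _).eq, pow_succ', ← mul_assoc _ d', D.cast_d', zero_mul,
      mul_zero]
  have h2 : ∑ i ∈ Finset.range p, (ι d * Y) ^ i * 1 * (ι d * Y) ^ (p - 1 - i) =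
      (p : Λ) * (ι d * Y) ^ (p - 1) := by
    rw [Finset.sum_congr rfl fun i hi => ?_, Finset.sum_const, Finset.card_range, nsmul_eq_mul]
    have hip : i + (p - 1 - i) = p - 1 := by have := Finset.mem_range.1 hi; omega
    rw [mul_one, ← pow_add, hip]
  rw [averageInner, h2, ← mul_assoc, ← map_natCast ι, ← map_mul, h1]
  simp

end Inner

section Total

variable (D : SplittingData σ p z d d') (hp : p ≠ 0) (hu : σ u = u)
  (hσ : ∀ s, (σ ^ p) s = u * s * (↑u⁻¹ : S)) (hY : ∀ s, Y * ι s = ι (σ s) * Y)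
  (hYp : Y ^ p = ι u - ι (u * d) * Y)

include D hσ hY in
theorem average_commute_ι {φ : Λ} (hφ : ∀ s, φ * ι s = ι s * φ) (s : S) :
    average σ p z d d' ι u Y φ * ι s = ι s * average σ p z d d' ι u Y φ := by
  rw [average, add_mul, mul_add, averageOrbit_commute_ι D hσ hY hφ,
    averageInner_commute_ι D hσ hY hφ]

include D hp hu hσ hY hYp in
theorem average_commute {φ : Λ} (hφ : ∀ s, φ * ι s = ι s * φ) :
    average σ p z d d' ι u Y φ * Y = Y * average σ p z d d' ι u Y φ := by
  rw [average, add_mul, mul_add, averageOrbit_commute D hu hσ hY hYp hφ,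
    averageInner_commute D hp hσ hY hYp hφ]

include D hp hYp in
theorem average_one : average σ p z d d' ι u Y 1 = 1 := by
  rw [average, averageOrbit_one D hYp, averageInner_one D hp, ← map_add, add_comm, D.d_mul,
    map_one]

end Total

end Averaging

/-! ### Maschke's theorem for splitting data. -/

/-- A ring generated by the image of a semisimple ring `S` and an element `Y` that satisfies a
relation governed by splitting data is semisimple. -/
theorem isSemisimpleRing {R : Type*} [Ring R] [IsSemisimpleRing S] {ι : S →+* R} {u : Sˣ} {Y : R}
    (D : SplittingData σ p z d d') (hp : p ≠ 0) (hu : σ u = u)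
    (hσ : ∀ s, (σ ^ p) s = u * s * (↑u⁻¹ : S)) (hY : ∀ s, Y * ι s = ι (σ s) * Y)
    (hYp : Y ^ p = ι u - ι (u * d) * Y)
    (hgen : Subring.closure (Set.range ι ∪ {Y}) = ⊤) : IsSemisimpleRing R := by
  refine { exists_isCompl := fun N => ?_ }
  let _ : Module S R := Module.compHom R ι
  let N' : Submodule S R :=
    { N with smul_mem' := fun s x hx => N.smul_mem (ι s) hx }
  obtain ⟨P, hP⟩ := exists_isCompl N'
  let ψ : R →ₗ[S] R := Submodule.projection N' P hP
  have hψ_mem (r : R) : ψ r ∈ N := Submodule.projection_apply_mem hP r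
  have hψ (r : R) (hr : r ∈ N) : ψ r = r := Submodule.projection_apply_left hP ⟨r, hr⟩
  -- The averaging takes place in the additive endomorphisms of `R`, with `R` acting by left
  -- multiplication and `φ` the `S`-linear projection onto `N`.
  let L : R →+* AddMonoid.End R := Module.toAddMonoidEnd R R
  let φ : AddMonoid.End R := ψ.toAddMonoidHom
  have hφ (s : S) : φ * (L.comp ι) s = (L.comp ι) s * φ :=
    AddMonoidHom.ext fun x => ψ.map_smul s x
  have hY' (s : S) : L Y * (L.comp ι) s = (L.comp ι) (σ s) * L Y := by
    simp only [RingHom.comp_apply, ← map_mul, hY]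
  have hYp' : L Y ^ p = (L.comp ι) u - (L.comp ι) (u * d) * L Y := by
    simp only [RingHom.comp_apply, ← map_mul, ← map_pow, ← map_sub, hYp]
  set T := average σ p z d d' (L.comp ι) u (L Y) φ with hT
  have hTcomm (r : R) : T * L r = L r * T := by
    have hr : r ∈ Subring.closure (Set.range ι ∪ {Y}) := hgen ▸ Subring.mem_top r
    induction hr using Subring.closure_induction with
    | mem x hx =>
      rcases hx with ⟨s, rfl⟩ | rfl
      · exact average_commute_ι D hσ hY' hφ s
      · exact average_commute D hp hu hσ hY' hYp' hφ
    | zero => simp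
    | one => simp
    | add x y _ _ hx hy => rw [map_add, mul_add, add_mul, hx, hy]
    | neg x _ hx =>
      refine AddMonoidHom.ext fun y => ?_
      have h : T (x * y) = x * T y := DFunLike.congr_fun hx y
      change T (-x * y) = -x * T y
      rw [neg_mul, neg_mul, map_neg, h]
    | mul x y _ _ hx hy => rw [map_mul, ← mul_assoc, hx, mul_assoc, hy, mul_assoc]
  -- Every term of the average has the shape `L a * φ * L b`. Hence the average lands in `N`, and on
  -- `N` it equals the average of the identity, which is the identity.
  have hmem (a b x : R) : (L a * φ * L b) x ∈ N := N.smul_mem a (hψ_mem (b * x))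
  have hfix (a b x : R) (hx : x ∈ N) : (L a * φ * L b) x = (L a * 1 * L b) x :=
    congrArg (a * ·) (hψ (b * x) (N.smul_mem b hx))
  have hexp (θ : AddMonoid.End R) (x : R) : average σ p z d d' (L.comp ι) u (L Y) θ x =
      ∑ i ∈ Finset.range p, (L (ι ((σ ^ i) z * (↑u⁻¹ : S)) * Y ^ i) * θ * L (Y ^ (p - i))) x +
      ((L (ι (d * d')) * θ * L 1) x + ∑ i ∈ Finset.range p,
        (L (ι ((↑u⁻¹ : S) * d' ^ p) * (ι d * Y) ^ i) * θ * L ((ι d * Y) ^ (p - 1 - i))) x) := by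
    let ev : AddMonoid.End R →+ R := AddMonoidHom.eval x
    have hev (θ : AddMonoid.End R) : θ x = ev θ := rfl
    simp only [hev, ← map_sum, ← map_add]
    simp only [average, averageOrbit, averageInner, Finset.mul_sum, RingHom.comp_apply, map_mul,
      map_pow, map_one, mul_one, mul_assoc]
  have hTmem (x : R) : T x ∈ N := by
    rw [hT, hexp]
    exact add_mem (sum_mem fun i _ => hmem _ _ _)
      (add_mem (hmem _ _ _) (sum_mem fun i _ => hmem _ _ _))
  have hTfix (x : R) (hx : x ∈ N) : T x = x := by
    have h1 : T x = average σ p z d d' (L.comp ι) u (L Y) 1 x := by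
      rw [hT, hexp, hexp]
      simp only [hfix _ _ x hx]
    rw [h1, average_one D hp hYp']
    rfl
  let f : R →ₗ[R] N :=
    { toFun := fun x => ⟨T x, hTmem x⟩
      map_add' := fun x y => Subtype.ext (map_add T x y)
      map_smul' := fun r x => Subtype.ext (DFunLike.congr_fun (hTcomm r) x) }
  exact ⟨_, LinearMap.isCompl_of_proj (f := f) fun x => Subtype.ext (hTfix x x.2)⟩

end SplittingData

/-! ### Quotients of skew polynomial rings by a normal element. -/

namespace SkewPoly

open SkewPolynomial

variable {F B : Type*} [Field F] [Ring B] [Algebra F B] {η : B ≃ₐ[F] B}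

theorem smul_of (n : ℕ) (b : B) :
    Multiplicative.ofAdd n • Twisted.of η b = Twisted.of η ((η ^ n) b) := rfl

theorem X_pow_mul_C (n : ℕ) (b : B) :
    (X ^ n : SkewPoly η) * C (Twisted.of η b) = C (Twisted.of η ((η ^ n) b)) * X ^ n := by
  rw [← monomial_zero_left, X_pow_mul_monomial, φ_iterate_apply, smul_of, C_mul_X_pow_eq_monomial,
    zero_add]

theorem X_mul_C (b : B) :
    (X : SkewPoly η) * C (Twisted.of η b) = C (Twisted.of η (η b)) * X := by
  simpa using X_pow_mul_C (η := η) 1 b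

theorem coeff_mul_monomial (g : SkewPoly η) (m n : ℕ) (b : Twisted η) :
    (g * monomial m b).coeff (n + m) = g.coeff n * Multiplicative.ofAdd n • b := by
  induction g using SkewPolynomial.induction with
  | h0 => simp
  | ha k r q _ _ hq =>
    rw [add_mul, coeff_add, coeff_add, add_mul, hq, monomial_mul_monomial, φ_iterate_apply,
      coeff_monomial, coeff_monomial]
    congr 1
    by_cases h : k = n
    · subst h; simp
    · rw [if_neg h, if_neg (by omega), zero_mul]

/-- The skew polynomial `y ^ p - u + c y`. -/
def relation (η : B ≃ₐ[F] B) (p : ℕ) (u c : B) : SkewPoly η :=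
  X ^ p - C (Twisted.of η u) + C (Twisted.of η c) * X

/-- The conditions under which `relation η p u c` is a normal element of `B[y; η]`. -/
structure IsNormal (η : B ≃ₐ[F] B) (p : ℕ) (u c : B) : Prop where
  two_le : 2 ≤ p
  map_u : η u = u
  map_c : η c = c
  pow_u (b : B) : (η ^ p) b * u = u * b
  pow_c (b : B) : (η ^ p) b * c = c * η b

variable {p : ℕ} {u c : B}

theorem relation_mul_C (h : IsNormal η p u c) (b : B) :
    relation η p u c * C (Twisted.of η b) = C (Twisted.of η ((η ^ p) b)) * relation η p u c := by
  rw [relation, add_mul, sub_mul, mul_add, mul_sub, X_pow_mul_C, mul_assoc, X_mul_C,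
    ← mul_assoc (C _) (C _) X, ← mul_assoc (C _) (C _) X, ← C_mul, ← C_mul, ← C_mul, ← C_mul,
    ← map_mul, ← map_mul, ← map_mul, ← map_mul, h.pow_u, h.pow_c]

theorem relation_mul_X (h : IsNormal η p u c) :
    relation η p u c * X = X * relation η p u c := by
  rw [relation, add_mul, sub_mul, mul_add, mul_sub, X_mul_C, ← mul_assoc, X_mul_C, h.map_u,
    h.map_c, ← pow_succ, ← pow_succ']

theorem exists_relation_mul (h : IsNormal η p u c) (a : SkewPoly η) :
    ∃ a', relation η p u c * a = a' * relation η p u c := by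
  induction a using SkewPolynomial.induction with
  | h0 => exact ⟨0, by simp⟩
  | ha n r q _ _ hq =>
    obtain ⟨q', hq'⟩ := hq
    refine ⟨C (Twisted.of η ((η ^ p) ((Twisted.of η).symm r))) * X ^ n + q', ?_⟩
    have hX : relation η p u c * X ^ n = X ^ n * relation η p u c :=
      (show Commute (relation η p u c) X from relation_mul_X h).pow_right n
    have hC : relation η p u c * C r = _ := relation_mul_C h ((Twisted.of η).symm r)
    rw [mul_add, hq', ← C_mul_X_pow_eq_monomial, ← mul_assoc, hC, mul_assoc, hX, add_mul,
      mul_assoc]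

-- A normal element can be moved to the right past any factor, so the two-sided ideal is the left
-- ideal generated by it.
open scoped Pointwise in
theorem exists_eq_mul_relation (h : IsNormal η p u c) {x : SkewPoly η}
    (hx : x ∈ TwoSidedIdeal.span {relation η p u c}) : ∃ g, x = g * relation η p u c := by
  have hle : AddSubgroup.closure
      ((Set.univ : Set (SkewPoly η)) * ({relation η p u c} : Set (SkewPoly η)) * (Set.univ : Set (SkewPoly η))) ≤
      (AddMonoidHom.mulRight (relation η p u c)).range := by
    rw [AddSubgroup.closure_le]
    rintro _ ⟨_, ⟨a, -, _, rfl, rfl⟩, b, -, rfl⟩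
    obtain ⟨b', hb'⟩ := exists_relation_mul h b
    refine ⟨a * b', ?_⟩
    simp only [AddMonoidHom.mulRight_apply, mul_assoc, hb']
  obtain ⟨g, hg⟩ := hle (TwoSidedIdeal.mem_span_iff_mem_addSubgroup_closure.1 hx)
  exact ⟨g, hg.symm⟩

/-- The relation is monic of degree `p`; the bound `2 ≤ p` keeps the term `c y` below the leading
one. -/
theorem coeff_mul_relation (hp : 2 ≤ p) {g : SkewPoly η} {N : ℕ}
    (hg : ∀ n, N < n → g.coeff n = 0) :
    (g * relation η p u c).coeff (N + p) = g.coeff N := by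
  have h0 := coeff_mul_monomial g 0 (N + p) (Twisted.of η u)
  have h1 := coeff_mul_monomial g 1 (N + p - 1) (Twisted.of η c)
  have h2 := coeff_mul_monomial g p N (1 : Twisted η)
  rw [hg _ (by omega), zero_mul] at h0 h1
  rw [show N + p - 1 + 1 = N + p by omega] at h1
  rw [relation, mul_add, mul_sub, coeff_add, coeff_sub, C_mul_X_eq_monomial,
    ← monomial_one_right_eq_X_pow, ← monomial_zero_left, h1, h2]
  erw [h0]
  simp

theorem eq_zero_of_mem_span (h : IsNormal η p u c) {x : SkewPoly η}
    (hx : x ∈ TwoSidedIdeal.span {relation η p u c}) (hdeg : ∀ n, p ≤ n → x.coeff n = 0) :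
    x = 0 := by
  obtain ⟨g, rfl⟩ := exists_eq_mul_relation h hx
  suffices g = 0 by rw [this, zero_mul]
  by_contra hg
  have hne : g.support.Nonempty := by
    rw [Finset.nonempty_iff_ne_empty, Ne, support_eq_empty]
    exact hg
  have hmax : ∀ n, g.support.max' hne < n → g.coeff n = 0 := fun n hn => by
    by_contra hn'
    exact absurd (g.support.le_max' n (mem_support_iff.2 hn')) (not_le.2 hn)
  have h1 := coeff_mul_relation (u := u) (c := c) h.two_le hmax
  rw [hdeg _ (Nat.le_add_left _ _)] at h1
  exact mem_support_iff.1 (g.support.max'_mem hne) h1.symm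

/-- The map `B → B[y; η] / ⟨f⟩`. -/
def quotientMap (f : SkewPoly η) : B →ₐ[F] SkewQuotient f where
  toRingHom := ((TwoSidedIdeal.span {f}).ringCon.mk').comp
    (CRingHom.comp (Twisted.of η : B →+* Twisted η))
  commutes' _ := rfl

/-- The class of `y` in `B[y; η] / ⟨f⟩`. -/
def quotientX (f : SkewPoly η) : SkewQuotient f := (TwoSidedIdeal.span {f}).ringCon.mk' X

theorem quotientX_mul (f : SkewPoly η) (b : B) :
    quotientX f * quotientMap f b = quotientMap f (η b) * quotientX f :=
  congrArg (TwoSidedIdeal.span {f}).ringCon.mk' (X_mul_C b)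

theorem quotientX_pow_mul (f : SkewPoly η) (n : ℕ) (b : B) :
    quotientX f ^ n * quotientMap f b = quotientMap f ((η ^ n) b) * quotientX f ^ n := by
  have := congrArg (TwoSidedIdeal.span {f}).ringCon.mk' (X_pow_mul_C n b)
  rwa [map_mul, map_mul, map_pow] at this

theorem quotientX_pow_eq :
    quotientX (relation η p u c) ^ p = quotientMap (relation η p u c) u -
      quotientMap (relation η p u c) c * quotientX (relation η p u c) := by
  set f := relation η p u c with hf
  have h : (TwoSidedIdeal.span {f}).ringCon.mk' f = 0 := by
    rw [← map_zero (TwoSidedIdeal.span {f}).ringCon.mk']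
    refine (RingCon.eq _).2 ?_
    rw [TwoSidedIdeal.rel_iff, sub_zero]
    exact TwoSidedIdeal.subset_span rfl
  have h2 : (TwoSidedIdeal.span {f}).ringCon.mk' f =
      quotientX f ^ p - quotientMap f u + quotientMap f c * quotientX f := by
    conv_lhs => arg 2; rw [hf, relation]
    rw [map_add, map_sub, map_mul, map_pow]
    rfl
  rw [h2] at h
  rw [eq_sub_iff_add_eq, ← sub_eq_zero, ← h]
  abel

/-- The linear combination of the classes of `1, y, …, y ^ (p - 1)` with given coefficients. -/
def quotientCombination (p : ℕ) (f : SkewPoly η) : (Fin p → B) →ₗ[F] SkewQuotient f :=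
  ∑ i : Fin p, (LinearMap.mulRight F (quotientX f ^ (i : ℕ))) ∘ₗ (quotientMap f).toLinearMap ∘ₗ
    LinearMap.proj i

theorem quotientCombination_apply (f : SkewPoly η) (a : Fin p → B) :
    quotientCombination p f a = ∑ i : Fin p, quotientMap f (a i) * quotientX f ^ (i : ℕ) := by
  simp [quotientCombination]

theorem monomial_mem_range (hp : 2 ≤ p) (n : ℕ) (b : B) :
    quotientMap (relation η p u c) b * quotientX (relation η p u c) ^ n ∈
      LinearMap.range (quotientCombination p (relation η p u c)) := by
  induction n using Nat.strong_induction_on generalizing b with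
  | _ n ih =>
    by_cases hn : n < p
    · refine ⟨Pi.single ⟨n, hn⟩ b, ?_⟩
      rw [quotientCombination_apply, Finset.sum_eq_single ⟨n, hn⟩]
      · simp
      · intro j _ hj
        simp [Pi.single_eq_of_ne hj]
      · simp
    -- Replacing `y ^ p` in `y ^ (m + p)` leaves degrees `m` and `m + 1`, both smaller since `2 ≤
    -- p`.
    · obtain ⟨m, rfl⟩ := Nat.exists_eq_add_of_le' (not_lt.1 hn)
      rw [pow_add, quotientX_pow_eq, mul_sub, ← mul_assoc (_ ^ m), quotientX_pow_mul,
        quotientX_pow_mul, mul_assoc _ _ (quotientX _), ← pow_succ, mul_sub, ← mul_assoc,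
        ← mul_assoc, ← map_mul, ← map_mul]
      exact sub_mem (ih _ (by omega) _) (ih _ (by omega) _)

theorem quotientCombination_surjective (hp : 2 ≤ p) :
    Function.Surjective (quotientCombination p (relation η p u c)) := by
  rw [← LinearMap.range_eq_top, Submodule.eq_top_iff']
  intro x
  obtain ⟨g, rfl⟩ := RingCon.mk'_surjective _ x
  induction g using SkewPolynomial.induction with
  | h0 => rw [map_zero]; exact zero_mem _
  | ha n r q _ _ hq =>
    rw [map_add, ← C_mul_X_pow_eq_monomial, map_mul, map_pow]
    exact add_mem (monomial_mem_range hp n ((Twisted.of η).symm r)) hq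

theorem mk'_sum (f : SkewPoly η) (a : Fin p → B) :
    (TwoSidedIdeal.span {f}).ringCon.mk'
      (∑ i : Fin p, C (Twisted.of η (a i)) * X ^ (i : ℕ)) = quotientCombination p f a := by
  rw [quotientCombination_apply, map_sum]
  simp only [map_mul, map_pow]
  rfl

theorem isFreeOnPowers (h : IsNormal η p u c) : IsFreeOnPowers p (relation η p u c) := by
  intro x
  obtain ⟨a, rfl⟩ := quotientCombination_surjective h.two_le x
  refine ⟨a, (mk'_sum _ a).symm, fun a' ha' => ?_⟩
  rw [← mk'_sum] at ha'
  have hmem := (TwoSidedIdeal.rel_iff _ _ _).1 ((RingCon.eq _).1 ha')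
  have hcoeff (a : Fin p → B) (n : ℕ) :
      (∑ i : Fin p, C (Twisted.of η (a i)) * X ^ (i : ℕ) : SkewPoly η).coeff n =
        ∑ i : Fin p, if (i : ℕ) = n then Twisted.of η (a i) else 0 := by
    let l : SkewPoly η →+ Twisted η :=
      { toFun := fun g => g.coeff n, map_zero' := rfl, map_add' := fun g g' => coeff_add g g' n }
    change l _ = _
    rw [map_sum]
    refine Finset.sum_congr rfl fun i _ => ?_
    rw [C_mul_X_pow_eq_monomial]
    exact coeff_monomial
  have h0 := eq_zero_of_mem_span h hmem fun n hn => by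
    rw [coeff_sub, hcoeff, hcoeff, ← Finset.sum_sub_distrib]
    refine Finset.sum_eq_zero fun i _ => ?_
    rw [if_neg (by omega), if_neg (by omega), sub_zero]
  funext j
  have hj := congrArg (coeff · (j : ℕ)) (sub_eq_zero.1 h0)
  simp only [hcoeff, Fin.val_inj, Finset.sum_ite_eq', Finset.mem_univ, if_true] at hj
  exact ((Twisted.of η).injective hj).symm

end SkewPoly

/-! ### The Skolem–Noether theorem. -/

section SkolemNoether

open MulOpposite

variable {K S : Type*} [Field K] [Ring S] [Algebra K S] [IsSimpleRing S]

-- The twisting relation makes `S d` and `d S` two-sided ideals, so by simplicity both contain `1`.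
omit [Field K] [Algebra K S] in
theorem isUnit_of_twist {σ : S → S} {d : S} (hd : d ≠ 0)
    (hσ : Function.Surjective σ) (h : ∀ b, d * σ b = b * d) : IsUnit d := by
  let I : TwoSidedIdeal S := TwoSidedIdeal.mk' (Set.range (· * d)) ⟨0, zero_mul d⟩
    (by rintro _ _ ⟨a, rfl⟩ ⟨b, rfl⟩; exact ⟨a + b, add_mul a b d⟩)
    (by rintro _ ⟨a, rfl⟩; exact ⟨-a, neg_mul a d⟩)
    (by rintro x _ ⟨a, rfl⟩; exact ⟨x * a, mul_assoc x a d⟩)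
    (by
      rintro _ y ⟨a, rfl⟩
      obtain ⟨b, rfl⟩ := hσ y
      exact ⟨a * b, by simp only [mul_assoc, h]⟩)
  let J : TwoSidedIdeal S := TwoSidedIdeal.mk' (Set.range (d * ·)) ⟨0, mul_zero d⟩
    (by rintro _ _ ⟨a, rfl⟩ ⟨b, rfl⟩; exact ⟨a + b, mul_add d a b⟩)
    (by rintro _ ⟨a, rfl⟩; exact ⟨-a, mul_neg d a⟩)
    (by rintro x _ ⟨a, rfl⟩; exact ⟨σ x * a, by simp only [← mul_assoc, h]⟩)
    (by rintro _ y ⟨a, rfl⟩; exact ⟨a * y, (mul_assoc d a y).symm⟩)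
  have hI (x : S) : x ∈ I ↔ x ∈ Set.range (· * d) := TwoSidedIdeal.mem_mk' ..
  have hJ (x : S) : x ∈ J ↔ x ∈ Set.range (d * ·) := TwoSidedIdeal.mem_mk' ..
  obtain ⟨a, ha⟩ := (hI 1).1 (IsSimpleRing.one_mem_of_ne_zero_mem I hd
    ((hI d).2 ⟨1, one_mul d⟩))
  obtain ⟨b, hb⟩ := (hJ 1).1 (IsSimpleRing.one_mem_of_ne_zero_mem J hd
    ((hJ d).2 ⟨1, mul_one d⟩))
  exact isUnit_iff_exists_and_exists.2 ⟨⟨b, hb⟩, ⟨a, ha⟩⟩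

variable [Algebra.IsCentral K S] [Module.Finite K S]

/-- `S` is a simple module over `S ⊗ Sᵐᵒᵖ` whose endomorphisms are the scalars `K`, so Jacobson
density realizes every `K`-linear map on a finite basis. -/
theorem mulLeftRight_surjective : Function.Surjective (AlgHom.mulLeftRight K S) := by
  let _ : Module (S ⊗[K] Sᵐᵒᵖ) S := TensorProduct.Algebra.module
  have hsmul (r : S ⊗[K] Sᵐᵒᵖ) (x : S) : r • x = AlgHom.mulLeftRight K S r x := rfl
  have hsimple : IsSimpleModule (S ⊗[K] Sᵐᵒᵖ) S := by
    rw [isSimpleModule_iff]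
    refine { exists_pair_ne := ⟨⊥, ⊤, bot_ne_top⟩, eq_bot_or_eq_top := fun N => ?_ }
    let I : TwoSidedIdeal S := TwoSidedIdeal.mk' (N : Set S) N.zero_mem N.add_mem N.neg_mem
      (fun {x y} hy => by simpa [hsmul] using N.smul_mem (x ⊗ₜ op 1) hy)
      (fun {x y} hx => by simpa [hsmul] using N.smul_mem (1 ⊗ₜ op y) hx)
    have hI (x : S) : x ∈ I ↔ x ∈ N := TwoSidedIdeal.mem_mk' ..
    rcases eq_bot_or_eq_top I with h | h
    · left
      ext x
      rw [← hI, h, TwoSidedIdeal.mem_bot, Submodule.mem_bot]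
    · right
      ext x
      rw [← hI, h]
      simp
  intro g
  have hend (e : Module.End (S ⊗[K] Sᵐᵒᵖ) S) : ∃ k : K, ∀ x, e x = k • x := by
    have h1 (x : S) : e x = x * e 1 := by
      simpa [hsmul] using e.map_smul (x ⊗ₜ op 1) 1
    have h2 (x : S) : e x = e 1 * x := by
      simpa [hsmul] using e.map_smul (1 ⊗ₜ op x) 1
    obtain ⟨k, hk⟩ := (Algebra.IsCentral.mem_center_iff K).1
      (Subalgebra.mem_center_iff.2 fun x => (h1 x).symm.trans (h2 x) : e 1 ∈ Subalgebra.center K S)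
    exact ⟨k, fun x => by rw [h2, hk, Algebra.smul_def]⟩
  let f : Module.End (Module.End (S ⊗[K] Sᵐᵒᵖ) S) S :=
    { toFun := g
      map_add' := map_add g
      map_smul' := fun e x => by
        obtain ⟨k, hk⟩ := hend e
        simp only [Module.End.smul_def, RingHom.id_apply, hk, map_smul] }
  classical
  let b := Module.finBasis K S
  obtain ⟨r, hr⟩ := jacobson_density f (Finset.univ.image b)
  refine ⟨r, b.ext fun i => ?_⟩
  exact (hr (b i) (by simp)).symm

theorem mulLeftRight_injective : Function.Injective (AlgHom.mulLeftRight K S) := by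
  have h : Module.finrank K (S ⊗[K] Sᵐᵒᵖ) = Module.finrank K (Module.End K S) := by
    rw [Module.finrank_tensorProduct, Module.finrank_linearMap, ← (opLinearEquiv K (M := S)).finrank_eq]
  exact (LinearMap.injective_iff_surjective_of_finrank_eq_finrank h
    (f := (AlgHom.mulLeftRight K S).toLinearMap)).2 mulLeftRight_surjective

/-- The **Skolem–Noether theorem** for automorphisms of a central simple algebra. -/
theorem exists_isUnit_twist (σ : S ≃ₐ[K] S) : ∃ d : S, IsUnit d ∧ ∀ b, d * σ b = b * d := by
  obtain ⟨l, hl⟩ : ∃ l : S →ₗ[K] K, l 1 = 1 :=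
    Module.Projective.exists_dual_eq_one K one_ne_zero
  -- `T` represents `x ↦ l x • 1`. Its values are scalars, so left and right multiplication by `b`
  -- agree after it; twisting the right factor by `σ` turns this into the required relation for any
  -- value of the twisted operator.
  obtain ⟨T, hT⟩ := mulLeftRight_surjective ((Algebra.linearMap K S).comp l)
  let ψ : S ⊗[K] Sᵐᵒᵖ →ₐ[K] S ⊗[K] Sᵐᵒᵖ :=
    (Algebra.TensorProduct.congr AlgEquiv.refl (AlgEquiv.op σ)).toAlgHom
  have hψ : Function.Injective ψ :=
    (Algebra.TensorProduct.congr AlgEquiv.refl (AlgEquiv.op σ)).injective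
  have hT0 : T ≠ 0 := by
    rintro rfl
    have := congrArg (fun g : Module.End K S => g 1) hT
    simp [hl] at this
  have hcomm (b : S) : (b ⊗ₜ[K] op 1) * T = ((1 : S) ⊗ₜ[K] op b) * T := by
    apply mulLeftRight_injective
    ext x
    rw [map_mul, map_mul, hT]
    simp [Algebra.commutes]
  obtain ⟨c, hc⟩ : ∃ c, AlgHom.mulLeftRight K S (ψ T) c ≠ 0 := by
    by_contra! h
    refine hT0 (hψ (mulLeftRight_injective ?_))
    ext x
    simp [h]
  have hd (b : S) : AlgHom.mulLeftRight K S (ψ T) c * σ b = b * AlgHom.mulLeftRight K S (ψ T) c := by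
    have := congrArg (fun t => AlgHom.mulLeftRight K S (ψ t) c) (hcomm b)
    simpa [ψ] using this.symm
  exact ⟨_, isUnit_of_twist hc σ.surjective hd, hd⟩

end SkolemNoether

/-- The center of a simple algebra, as a field. -/
def CenterField (F S : Type*) [Field F] [Ring S] [Algebra F S] : Type _ := Subalgebra.center F S

namespace CenterField

variable {F S : Type*} [Field F] [Ring S] [Algebra F S] [IsSimpleRing S]

instance : Field (CenterField F S) :=
  (IsSimpleRing.isField_center S : IsField (Subalgebra.center F S)).toField

/-- The inclusion of the center. -/
def val : CenterField F S →+* S := ((Subalgebra.center F S).val : Subalgebra.center F S →+* S)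

theorem val_comm (x : CenterField F S) (s : S) : val x * s = s * val x :=
  (Subalgebra.mem_center_iff.1 x.2 s).symm

instance : Algebra (CenterField F S) S := val.toAlgebra' val_comm

instance : Algebra F (CenterField F S) :=
  (algebraMap F (Subalgebra.center F S) : F →+* CenterField F S).toAlgebra

instance : IsScalarTower F (CenterField F S) S := .of_algebraMap_eq fun _ => rfl

instance : Algebra.IsCentral (CenterField F S) S :=
  ⟨fun x hx => Algebra.mem_bot.2
    ⟨⟨x, Subalgebra.mem_center_iff.2 (Subalgebra.mem_center_iff.1 hx)⟩, rfl⟩⟩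

instance [Module.Finite F S] : Module.Finite (CenterField F S) S :=
  Module.Finite.of_restrictScalars_finite F _ _

end CenterField

/-- The **Skolem–Noether theorem**: an endomorphism of a finite-dimensional simple algebra that
fixes the center is inner. -/
theorem exists_isUnit_twist_of_fixes_center (F : Type*) {S : Type*} [Field F] [Ring S] [Algebra F S]
    [IsSimpleRing S] [Module.Finite F S] (σ : S →+* S)
    (hσ : ∀ z, (∀ s, z * s = s * z) → σ z = z) :
    ∃ d : S, IsUnit d ∧ ∀ b, d * σ b = b * d := by
  let f : S →ₐ[CenterField F S] S :=
    { σ with commutes' := fun z => hσ _ (CenterField.val_comm z) }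
  have hf : Function.Injective f := f.toRingHom.injective
  exact exists_isUnit_twist
    (AlgEquiv.ofBijective f ⟨hf, (LinearMap.injective_iff_surjective (f := f.toLinearMap)).1 hf⟩)

/-! ### Cyclic actions on reduced commutative algebras. -/

section Commutative

variable {F Z : Type*} [Field F] [CommRing Z] [Algebra F Z] [Module.Finite F Z] [IsReduced Z]
  {p : ℕ} {τ : Z →+* Z}

-- By Dedekind's independence of characters, the maps `χ ∘ τ ^ i` cannot be distinct if their sum
-- vanishes. A coincidence makes `χ` invariant under some `τ ^ m` with `0 < m < p`, and `m` is
-- invertible modulo the prime `p`.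
omit [IsReduced Z] in
theorem apply_eq_of_orbitSum_eq_zero {Ω : Type*} [Field Ω] (hp : p.Prime) (hτ : τ ^ p = 1)
    (χ : Z →+* Ω) (h : ∀ w, χ (orbitSum τ p w) = 0) (w : Z) : χ (τ w) = χ w := by
  let g : Fin p → Z →* Ω := fun i => (χ.comp (τ ^ (i : ℕ)) : Z →* Ω)
  have hg : ¬ Function.Injective g := by
    intro hinj
    have hli := (linearIndependent_monoidHom Z Ω).comp g hinj
    rw [Fintype.linearIndependent_iff] at hli
    refine one_ne_zero (hli (fun _ => 1) ?_ ⟨0, hp.pos⟩)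
    ext w
    have := h w
    rw [orbitSum, map_sum, ← Fin.sum_univ_eq_sum_range (fun i => χ ((τ ^ i) w))] at this
    simpa [g, Finset.sum_apply] using this
  have hmod (m n : ℕ) (h : m ≡ n [MOD p]) : τ ^ m = τ ^ n := pow_eq_pow_of_modEq h hτ
  obtain ⟨i, j, hij, hlt⟩ : ∃ i j : Fin p, g i = g j ∧ i < j := by
    simp only [Function.Injective, not_forall] at hg
    obtain ⟨i, j, hij, hne⟩ := hg
    rcases lt_or_gt_of_ne hne with hlt | hlt
    exacts [⟨i, j, hij, hlt⟩, ⟨j, i, hij.symm, hlt⟩]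
  have hk (w : Z) : χ ((τ ^ (j - i : ℕ)) w) = χ w := by
    have h1 : χ ((τ ^ (i : ℕ)) ((τ ^ (p - i)) w)) = χ ((τ ^ (j : ℕ)) ((τ ^ (p - i)) w)) :=
      DFunLike.congr_fun hij _
    have hadd (a b : ℕ) (x : Z) : (τ ^ a) ((τ ^ b) x) = (τ ^ (a + b)) x := by
      rw [pow_add, RingHom.mul_def, RingHom.comp_apply]
    rw [hadd, hadd] at h1
    have hi := i.2
    rw [show (i : ℕ) + (p - i) = p by omega, hτ, show (j : ℕ) + (p - i) = (j - i) + p by omega,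
      pow_add, hτ, mul_one] at h1
    exact h1.symm
  have hkn (n : ℕ) (w : Z) : χ ((τ ^ ((j - i : ℕ) * n)) w) = χ w := by
    induction n generalizing w with
    | zero => simp
    | succ n ih => rw [mul_add, mul_one, pow_add, RingHom.mul_def, RingHom.comp_apply, ih, hk]
  have hcop : Nat.Coprime (j - i : ℕ) p := by
    refine (Nat.Prime.coprime_iff_not_dvd hp).2 (fun hdvd => ?_) |>.symm
    have := Nat.le_of_dvd (by omega) hdvd
    omega
  obtain ⟨n, -, hn⟩ := Nat.exists_mul_mod_eq_one_of_coprime hcop hp.one_lt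
  have h1 : τ ^ ((j - i : ℕ) * n) = τ ^ 1 := hmod _ _ (by
    rw [Nat.ModEq, hn, Nat.mod_eq_of_lt hp.one_lt])
  rw [← hkn n w, h1, pow_one]

omit [IsReduced Z] in
theorem map_orbitSum (hτ : τ ^ p = 1) (w : Z) : τ (orbitSum τ p w) = orbitSum τ p w := by
  have h : ∀ i, τ ((τ ^ i) w) = (τ ^ (i + 1)) w := fun i => by
    rw [pow_succ', RingHom.mul_def, RingHom.comp_apply]
  rw [orbitSum, map_sum]
  simp only [h]
  have h4 := (Finset.sum_range_succ (fun i => (τ ^ i) w) p).symm.trans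
    (Finset.sum_range_succ' (fun i => (τ ^ i) w) p)
  rw [hτ, pow_zero] at h4
  exact (add_right_cancel h4).symm

omit [IsReduced Z] in
theorem orbitSum_mul {a : Z} (ha : τ a = a) (w : Z) :
    orbitSum τ p (a * w) = a * orbitSum τ p w := by
  have h : ∀ i, (τ ^ i) a = a := fun i => by
    induction i with
    | zero => simp
    | succ i ih => rw [pow_succ, RingHom.mul_def, RingHom.comp_apply, ha, ih]
  simp only [orbitSum, map_mul, h, Finset.mul_sum]

variable (F) in
/-- Splitting of a reduced algebra with a cyclic action into a component on which the trace is
surjective and a component on which the action is trivial. -/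
theorem exists_orbitSum_splitting (hp : p.Prime) (τ : Z →ₐ[F] Z)
    (hτ : (τ : Z →+* Z) ^ p = 1) :
    ∃ z : Z, orbitSum (τ : Z →+* Z) p z * z = z ∧ τ (orbitSum (τ : Z →+* Z) p z) = orbitSum τ p z ∧
      orbitSum (τ : Z →+* Z) p z * orbitSum (τ : Z →+* Z) p z = orbitSum (τ : Z →+* Z) p z ∧
      ∀ w, τ w * (1 - orbitSum (τ : Z →+* Z) p z) = w * (1 - orbitSum (τ : Z →+* Z) p z) := by
  let Z₀ : Subalgebra F Z := AlgHom.equalizer τ (AlgHom.id F Z)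
  have hZ₀ (x : Z₀) : τ x = x := x.2
  have : IsArtinianRing Z₀ := IsArtinianRing.of_finite F Z₀
  have : IsReduced Z₀ := isReduced_of_injective Z₀.val Subtype.val_injective
  -- The traces form an ideal of the fixed ring, which is reduced and Artinian, hence semisimple; so
  -- the ideal has an idempotent generator `ε`.
  let I : Ideal Z₀ :=
    { carrier := {x | ∃ w, orbitSum (τ : Z →+* Z) p w = x}
      zero_mem' := ⟨0, by simp [orbitSum]⟩
      add_mem' := by
        rintro a b ⟨v, hv⟩ ⟨w, hw⟩
        exact ⟨v + w, by simp [← hv, ← hw, orbitSum, Finset.sum_add_distrib]⟩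
      smul_mem' := by
        rintro a b ⟨w, hw⟩
        exact ⟨a * w, by rw [orbitSum_mul (τ := (τ : Z →+* Z)) (hZ₀ a), hw]; rfl⟩ }
  have : IsSemisimpleRing Z₀ := IsArtinianRing.isSemisimpleRing_of_isReduced Z₀
  obtain ⟨ε, hε, hI⟩ := IsSemisimpleRing.ideal_eq_span_idempotent I
  obtain ⟨w, hw⟩ : ε ∈ I := hI ▸ Ideal.mem_span_singleton_self ε
  have hεZ : (ε : Z) * ε = ε := congrArg Subtype.val hε
  have hεw : orbitSum (τ : Z →+* Z) p (ε * w) = ε := by rw [orbitSum_mul (τ := (τ : Z →+* Z)) (hZ₀ ε), hw, hεZ]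
  have htr (v : Z) : orbitSum (τ : Z →+* Z) p v * (1 - ε) = 0 := by
    have hv : (⟨_, map_orbitSum hτ v⟩ : Z₀) ∈ I := ⟨v, rfl⟩
    rw [hI, Ideal.mem_span_singleton] at hv
    obtain ⟨a, ha⟩ := hv
    have ha' : orbitSum (τ : Z →+* Z) p v = ε * a := congrArg Subtype.val ha
    rw [ha', mul_comm (ε : Z), mul_assoc, mul_sub, mul_one, hεZ, sub_self, mul_zero]
  -- If `w` has trace `ε`, so has `ε * w`, which moreover is supported on `ε`.
  refine ⟨ε * w, ?_⟩
  rw [hεw]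
  refine ⟨by rw [← mul_assoc, hεZ], hZ₀ ε, hεZ, fun v => ?_⟩
  rw [← sub_eq_zero, ← sub_mul]
  have : IsArtinianRing Z := IsArtinianRing.of_finite F Z
  -- At a maximal ideal not containing `1 - ε` all traces vanish, so `τ` acts trivially on the
  -- residue classes. The Jacobson radical of a reduced Artinian ring is zero.
  have hmem : (τ v - v) * (1 - ε) ∈ (⊥ : Ideal Z).jacobson := by
    refine Submodule.mem_sInf.2 fun (m : Ideal Z) ⟨_, hm⟩ => ?_
    by_cases hε' : 1 - (ε : Z) ∈ m
    · exact m.mul_mem_left _ hε'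
    · let _ : Field (Z ⧸ m) := Ideal.Quotient.field m
      refine m.mul_mem_right _ ?_
      rw [← Ideal.Quotient.eq]
      refine apply_eq_of_orbitSum_eq_zero hp hτ (Ideal.Quotient.mk m) (fun x => ?_) v
      have h0 := congrArg (Ideal.Quotient.mk m) (htr x)
      rw [map_mul, map_zero, mul_eq_zero] at h0
      exact h0.resolve_right fun h => hε' (Ideal.Quotient.eq_zero_iff_mem.1 h)
  rw [IsArtinianRing.jacobson_eq_radical] at hmem
  obtain ⟨n, hn⟩ := hmem
  exact IsNilpotent.eq_zero ⟨n, hn⟩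

end Commutative

/-! ### Splitting data for semisimple algebras. -/

section Product

variable {F : Type*} [Field F] {ι : Type*} [Fintype ι] [DecidableEq ι] {A : ι → Type*}
  [∀ i, Ring (A i)] [∀ i, Algebra F (A i)] [∀ i, IsSimpleRing (A i)]

omit [Fintype ι] [∀ i, IsSimpleRing (A i)] in
theorem mem_center_pi_apply {x : ∀ i, A i} (hx : x ∈ Subalgebra.center F (∀ i, A i)) (i : ι) :
    x i ∈ Subalgebra.center F (A i) := by
  refine Subalgebra.mem_center_iff.2 fun s => ?_
  have := congrFun (Subalgebra.mem_center_iff.1 hx (Pi.single i s)) i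
  simpa using this

omit [Fintype ι] [∀ i, IsSimpleRing (A i)] in
theorem single_mem_center_pi {i : ι} {x : A i} (hx : x ∈ Subalgebra.center F (A i)) :
    Pi.single i x ∈ Subalgebra.center F (∀ i, A i) := by
  refine Subalgebra.mem_center_iff.2 fun s => ?_
  rw [← Pi.single_mul_left, ← Pi.single_mul_right, Subalgebra.mem_center_iff.1 hx]

omit [Fintype ι] [DecidableEq ι] in
theorem eq_zero_of_mem_center_of_mul_eq_zero {i : ι} {x y : A i}
    (hx : x ∈ Subalgebra.center F (A i)) (hy : y ∈ Subalgebra.center F (A i)) (h : x * y = 0) :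
    x = 0 ∨ y = 0 := by
  have h' : (⟨x, hx⟩ * ⟨y, hy⟩ : CenterField F (A i)) = 0 := Subtype.ext h
  exact (mul_eq_zero.1 h').imp (congrArg Subtype.val) (congrArg Subtype.val)

instance isReduced_center_pi : IsReduced (Subalgebra.center F (∀ i, A i)) where
  eq_zero x hx := by
    obtain ⟨n, hn⟩ := hx
    refine Subtype.ext (funext fun i => ?_)
    let y : CenterField F (A i) := ⟨x.1 i, mem_center_pi_apply x.2 i⟩
    have h : y ^ n = 0 := Subtype.ext (congrFun (congrArg Subtype.val hn) i)
    have hy : y = 0 := IsNilpotent.eq_zero ⟨n, h⟩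
    exact congrArg Subtype.val hy

variable [∀ i, Module.Finite F (A i)]

theorem exists_splittingData_pi {p : ℕ} (hp : p.Prime) (hpF : (p : F) = 0)
    (σ : (∀ i, A i) ≃ₐ[F] (∀ i, A i))
    (hσ : ∀ z ∈ Subalgebra.center F (∀ i, A i), ((σ : (∀ i, A i) →+* (∀ i, A i)) ^ p) z = z) :
    ∃ z d d', SplittingData (σ : (∀ i, A i) →+* (∀ i, A i)) p z d d' := by
  let R := ∀ i, A i
  set σ' : R →+* R := (σ : R →+* R) with hσ'
  let Z := Subalgebra.center F R
  have hσZ (x : Z) : σ x ∈ Z := Subalgebra.mem_center_iff.2 fun s => by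
    obtain ⟨s, rfl⟩ := σ.surjective s
    rw [← map_mul, ← map_mul, Subalgebra.mem_center_iff.1 x.2]
  let τ : Z →ₐ[F] Z := ((σ : R →ₐ[F] R).comp Z.val).codRestrict Z hσZ
  have hτ_pow (n : ℕ) (x : Z) : ((((τ : Z →+* Z) ^ n) x : Z) : R) = (σ' ^ n) x := by
    induction n generalizing x with
    | zero => simp
    | succ n ih =>
      rw [pow_succ, pow_succ, RingHom.mul_def, RingHom.mul_def, RingHom.comp_apply,
        RingHom.comp_apply, ih]
      rfl
  have hτ : (τ : Z →+* Z) ^ p = 1 := RingHom.ext fun x => Subtype.ext (by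
    rw [hτ_pow, hσ _ x.2]; rfl)
  obtain ⟨z, h1, h2, h3, h4⟩ := exists_orbitSum_splitting F hp τ hτ
  have hsum : ((orbitSum (τ : Z →+* Z) p z : Z) : R) = orbitSum σ' p z := by
    simp only [orbitSum, AddSubmonoidClass.coe_finsetSum, hτ_pow]
  set ε := orbitSum (τ : Z →+* Z) p z
  -- The center of a simple factor is a field, so a central idempotent is `0` or `1` there.
  have hε (i : ι) : ε.1 i = 0 ∨ ε.1 i = 1 := by
    have hc := mem_center_pi_apply ε.2 i
    have h := congrFun (congrArg Subtype.val h3) i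
    refine (eq_zero_of_mem_center_of_mul_eq_zero hc (sub_mem hc (one_mem _)) ?_).imp_right
      sub_eq_zero.1
    rw [mul_sub, mul_one]
    exact sub_eq_zero.2 h
  have hfix (i : ι) (hi : ε.1 i = 0) (x : A i) (hx : x ∈ Subalgebra.center F (A i)) :
      σ (Pi.single i x) = Pi.single i x := by
    have hs (y : A i) : Pi.single i y * (1 - ε.1) = Pi.single i y := by
      have h0 : (1 - ε.1) i = 1 - ε.1 i := rfl
      rw [← Pi.single_mul_left, h0, hi, sub_zero, mul_one]
    have ha : σ (Pi.single i x) * (1 - ε.1) = Pi.single i x * (1 - ε.1) :=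
      congrArg Subtype.val (h4 ⟨_, single_mem_center_pi hx⟩)
    have hb : σ (1 - ε.1) = 1 - ε.1 := by
      rw [map_sub, map_one]
      exact congrArg (1 - ·) (congrArg Subtype.val h2)
    rw [← hs, map_mul, hb, ha]
  -- Where `ε` vanishes, `σ` fixes the identity of the factor, hence preserves the factor, and it
  -- fixes its center; Skolem–Noether supplies `d`.
  have hloc (i : ι) : ∃ d d' : A i, (ε.1 i = 0 → d * d' = 1 ∧ d' * d = 1 ∧
      ∀ s : R, d * σ s i = s i * d) ∧ (ε.1 i = 1 → d = 0 ∧ d' = 0) := by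
    rcases hε i with hi | hi
    · have h1 : σ (Pi.single i 1) = Pi.single i 1 := hfix i hi 1 (one_mem _)
      have hσi (s : R) : σ s i = σ (Pi.single i (s i)) i := by
        have : Pi.single i (s i) = s * Pi.single i 1 := by rw [← Pi.single_mul_right, mul_one]
        rw [this, map_mul, h1]
        simp
      let f : A i →+* A i :=
        { toFun := fun x => σ (Pi.single i x) i
          map_one' := by rw [h1, Pi.single_eq_same]
          map_zero' := by simp
          map_mul' := fun x y => by rw [Pi.single_mul, map_mul]; rfl
          map_add' := fun x y => by rw [Pi.single_add, map_add]; rfl }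
      obtain ⟨d, ⟨v, rfl⟩, hd⟩ := exists_isUnit_twist_of_fixes_center F f fun x hx => by
        change σ (Pi.single i x) i = x
        rw [hfix i hi x (Subalgebra.mem_center_iff.2 fun s => (hx s).symm), Pi.single_eq_same]
      refine ⟨v, (↑v⁻¹ : A i), fun _ => ⟨v.mul_inv, v.inv_mul, fun s => ?_⟩, fun h => ?_⟩
      · rw [hσi]
        exact hd (s i)
      · exact absurd (hi.symm.trans h) zero_ne_one
    · exact ⟨0, 0, fun h => absurd (h.symm.trans hi) zero_ne_one, fun _ => ⟨rfl, rfl⟩⟩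
  choose d d' hd0 hd1 using hloc
  have htwist (s : R) : d * σ' s = s * d := funext fun i => by
    change d i * σ s i = s i * d i
    rcases hε i with hi | hi
    · exact (hd0 i hi).2.2 s
    · simp [(hd1 i hi).1]
  have hmul_d : d' * d + ε.1 = 1 := funext fun i => by
    change d' i * d i + ε.1 i = 1
    rcases hε i with hi | hi
    · simp [hi, (hd0 i hi).2.1]
    · simp [hi, (hd1 i hi).1]
  have hsum_d : ε.1 * d = 0 := funext fun i => by
    change ε.1 i * d i = 0
    rcases hε i with hi | hi
    · simp [hi]
    · simp [hi, (hd1 i hi).1]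
  have hR : (p : R) = 0 := by rw [← map_natCast (algebraMap F R), hpF, map_zero]
  refine ⟨z, d, d', ⟨fun i s => ?_, htwist, ?_, ?_, ?_, ?_, ?_, ?_, ?_⟩⟩
  · rw [← hτ_pow]
    exact (Subalgebra.mem_center_iff.1 (((τ : Z →+* Z) ^ i) z).2 s).symm
  -- Twisting `d` by itself gives `d * σ d = d * d`; cancel `d` on the complement of `ε`, where both
  -- `d` and `σ d` live.
  · have he : σ' ε.1 = ε.1 := congrArg Subtype.val h2
    have hed : (1 - ε.1) * d = d := by rw [sub_mul, hsum_d, one_mul, sub_zero]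
    have hed' : (1 - ε.1) * σ' d = σ' d := by
      rw [sub_mul, ← he, ← map_mul, hsum_d, one_mul, map_zero, sub_zero]
    rw [← hed', ← eq_sub_of_add_eq hmul_d, mul_assoc, htwist, ← mul_assoc,
      eq_sub_of_add_eq hmul_d, hed]
  · rw [← hsum]
    refine funext fun i => ?_
    change d i * d' i + ε.1 i = 1
    rcases hε i with hi | hi
    · simp [hi, (hd0 i hi).1]
    · simp [hi, (hd1 i hi).1]
  · rw [← hsum, hmul_d]
  · rw [← hsum]
    exact congrArg Subtype.val h1
  · rw [← hsum, hsum_d]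
  · rw [← hsum]
    refine funext fun i => ?_
    change ε.1 i * d' i = 0
    rcases hε i with hi | hi
    · simp [hi]
    · simp [hi, (hd1 i hi).2]
  · rw [hR, zero_mul]

end Product

section Semisimple

variable {F B : Type*} [Field F] [Ring B] [Algebra F B] [Module.Finite F B]

theorem exists_splittingData [IsSemisimpleRing B] {p : ℕ} (hp : p.Prime) (η : B ≃ₐ[F] B) (u : Bˣ)
    (hη : ∀ b, (η ^ p) b = u * b * (↑u⁻¹ : B)) :
    ∃ z d d', SplittingData (η : B →+* B) p z d d' := by
  have hpow (n : ℕ) (b : B) : ((η : B →+* B) ^ n) b = (η ^ n) b := by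
    induction n generalizing b with
    | zero => rfl
    | succ n ih => rw [pow_succ, pow_succ, RingHom.mul_def, RingHom.comp_apply, ih]; rfl
  by_cases hpF : (p : F) = 0
  · obtain ⟨n, D, m, _, _, _, _, ⟨e⟩⟩ :=
      IsSemisimpleRing.exists_algEquiv_pi_matrix_divisionRing_finite F B
    set R := ∀ i, Matrix (Fin (m i)) (Fin (m i)) (D i)
    let σ : R ≃ₐ[F] R := e.symm.trans (η.trans e)
    have hσpow (n : ℕ) (b : B) : ((σ : R →+* R) ^ n) (e b) = e ((η ^ n) b) := by
      induction n generalizing b with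
      | zero => rfl
      | succ n ih =>
        rw [pow_succ, pow_succ, RingHom.mul_def, RingHom.comp_apply, AlgEquiv.mul_apply, ← ih]
        simp [σ]
    obtain ⟨z, d, d', h⟩ := exists_splittingData_pi hp hpF σ (fun z hz => by
      obtain ⟨b, rfl⟩ := e.surjective z
      rw [hσpow, hη, map_mul, map_mul, Subalgebra.mem_center_iff.1 hz, mul_assoc, ← map_mul,
        Units.mul_inv, map_one, mul_one])
    refine ⟨_, _, _, h.map (e.symm : R →+* B) (fun s => ?_) (fun i s => ?_) (fun s => ?_)⟩
    · simp [σ]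
    · have := congrArg e.symm (h.comm i (e s))
      simpa using this
    · have := congrArg e.symm (h.twist (e s))
      simpa [σ] using this
  -- When `p` is invertible, the constant `1 / p` has trace `1` and the complementary component is
  -- zero.
  · refine ⟨algebraMap F B (p : F)⁻¹, 0, 0, ?_⟩
    have hpow' (n : ℕ) : ((η : B →+* B) ^ n) (algebraMap F B (p : F)⁻¹) =
        algebraMap F B (p : F)⁻¹ := by rw [hpow, AlgEquiv.commutes]
    have hsum : orbitSum (η : B →+* B) p (algebraMap F B (p : F)⁻¹) = 1 := by
      simp only [orbitSum, hpow']
      rw [Finset.sum_const, Finset.card_range, nsmul_eq_mul, ← map_natCast (algebraMap F B),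
        ← map_mul, mul_inv_cancel₀ hpF, map_one]
    constructor <;> simp [hsum, hpow', Algebra.commutes]

end Semisimple

/-! ### Base change to a larger field. -/

section BaseChange

variable {F : Type*} [Field F] {B : Type*} [Ring B] [Algebra F B]

/-- The Jacobson radical of `B` is nilpotent and stays so after extension. For `x` in it, the left
ideal generated by `1 ⊗ x` has an idempotent generator, which is then nilpotent, hence zero. -/
theorem isSemisimpleRing_of_tensorProduct {E : Type*} [Field E] [Algebra F E] [Module.Finite F B]
    [IsSemisimpleRing (E ⊗[F] B)] : IsSemisimpleRing B := by
  have : IsArtinianRing B := IsArtinianRing.of_finite F B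
  rw [IsArtinianRing.isSemisimpleRing_iff_jacobson, eq_bot_iff]
  intro x hx
  obtain ⟨n, hn⟩ := IsSemiprimaryRing.isNilpotent (R := B)
  let I := Ring.jacobson B
  let M (k : ℕ) : Submodule E (E ⊗[F] B) := Submodule.span E {w | ∃ y ∈ I ^ k, w = 1 ⊗ₜ y}
  have hmul (k : ℕ) (v w : E ⊗[F] B) (hv : v ∈ M k) (hw : w ∈ M 1) : v * w ∈ M (k + 1) := by
    induction hv using Submodule.span_induction with
    | zero => rw [zero_mul]; exact zero_mem _
    | add a b _ _ ha hb => rw [add_mul]; exact add_mem ha hb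
    | smul a b _ hb => rw [smul_mul_assoc]; exact Submodule.smul_mem _ _ hb
    | mem v hv =>
      obtain ⟨y, hy, rfl⟩ := hv
      induction hw using Submodule.span_induction with
      | zero => rw [mul_zero]; exact zero_mem _
      | add a b _ _ ha hb => rw [mul_add]; exact add_mem ha hb
      | smul a b _ hb => rw [mul_smul_comm]; exact Submodule.smul_mem _ _ hb
      | mem w hw =>
        obtain ⟨y', hy', rfl⟩ := hw
        refine Submodule.subset_span ⟨y * y', ?_, by simp⟩
        rw [Submodule.pow_succ]
        rw [Submodule.pow_one] at hy'
        exact Ideal.mul_mem_mul hy hy'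
  have hpow (w : E ⊗[F] B) (hw : w ∈ M 1) (k : ℕ) : w ^ (k + 1) ∈ M (k + 1) := by
    induction k with
    | zero => simpa using hw
    | succ k ih => rw [pow_succ]; exact hmul _ _ _ ih hw
  have hleft (s : E ⊗[F] B) : s * (1 ⊗ₜ x) ∈ M 1 := by
    induction s using TensorProduct.induction_on with
    | zero => rw [zero_mul]; exact zero_mem _
    | add a b ha hb => rw [add_mul]; exact add_mem ha hb
    | tmul e b =>
      have : (e ⊗ₜ[F] b) * (1 ⊗ₜ x) = e • ((1 : E) ⊗ₜ[F] (b * x)) := by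
        rw [Algebra.TensorProduct.tmul_mul_tmul, TensorProduct.smul_tmul', mul_one, smul_eq_mul,
          mul_one]
      rw [this]
      refine Submodule.smul_mem _ _ (Submodule.subset_span ⟨b * x, ?_, rfl⟩)
      rw [Submodule.pow_one]
      exact Ideal.mul_mem_left _ b hx
  obtain ⟨e, he, hspan⟩ :=
    IsSemisimpleRing.ideal_eq_span_idempotent (Ideal.span {(1 : E) ⊗ₜ[F] x})
  obtain ⟨s, hs⟩ := Ideal.mem_span_singleton'.1 (hspan ▸ Ideal.mem_span_singleton_self e)
  have he0 : e = 0 := by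
    have h1 : e ^ (n + 1) ∈ M (n + 1) := hpow e (hs ▸ hleft s) n
    have h2 : M (n + 1) = ⊥ := by
      rw [Submodule.span_eq_bot]
      rintro _ ⟨y, hy, rfl⟩
      have : I ^ (n + 1) = 0 := by rw [Submodule.pow_succ, hn, Submodule.zero_eq_bot, Submodule.bot_mul]
      rw [this] at hy
      rw [show y = 0 from hy, TensorProduct.tmul_zero]
    rw [he.pow_succ_eq, h2] at h1
    exact h1
  have hx0 : (1 : E) ⊗ₜ[F] x = 0 := by
    have h1 : (1 : E) ⊗ₜ[F] x ∈ Ideal.span {e} := hspan ▸ Ideal.mem_span_singleton_self _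
    rwa [he0, Ideal.span_singleton_zero] at h1
  have hinj : Function.Injective (Algebra.TensorProduct.includeRight : B →ₐ[F] E ⊗[F] B) :=
    Algebra.TensorProduct.includeRight_injective (algebraMap F E).injective
  exact hinj (hx0.trans (map_zero _).symm)

variable {η : B ≃ₐ[F] B} {p : ℕ} {z d d' : B} {u : Bˣ}

theorem SplittingData.isNormal (D : SplittingData (η : B →+* B) p z d d') (hp : 2 ≤ p)
    (hu : η u = u) (hη : ∀ b, (η ^ p) b = u * b * (↑u⁻¹ : B)) :
    SkewPoly.IsNormal η p u (u * d) where
  two_le := hp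
  map_u := hu
  map_c := by rw [map_mul, hu]; exact congrArg _ D.map_d
  pow_u b := by rw [hη, Units.inv_mul_cancel_right]
  pow_c b := by
    have := D.twist b
    rw [hη, ← mul_assoc, Units.inv_mul_cancel_right, mul_assoc, mul_assoc, ← this]
    rfl

theorem SplittingData.isSemisimpleRing_tensorProduct (D : SplittingData (η : B →+* B) p z d d')
    (E : Type*) [Field E] [Algebra F E] [IsSemisimpleRing (E ⊗[F] B)] {A : Type*} [Ring A]
    [Algebra F A] (g : B →ₐ[F] A) (y : A) (hp : p ≠ 0) (hu : η u = u)
    (hη : ∀ b, (η ^ p) b = u * b * (↑u⁻¹ : B)) (hy : ∀ b, y * g b = g (η b) * y)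
    (hyp : y ^ p = g u - g (u * d) * y)
    (hgen : ∀ x, ∃ a : Fin p → B, x = ∑ i : Fin p, g (a i) * y ^ (i : ℕ)) :
    IsSemisimpleRing (E ⊗[F] A) := by
  let σ : E ⊗[F] B →ₐ[E] E ⊗[F] B := Algebra.TensorProduct.map (AlgHom.id E E) (η : B →ₐ[F] B)
  let ι : E ⊗[F] B →ₐ[E] E ⊗[F] A := Algebra.TensorProduct.map (AlgHom.id E E) g
  let j : B →ₐ[F] E ⊗[F] B := Algebra.TensorProduct.includeRight
  have hcenter (a : B) (ha : ∀ b, a * b = b * a) (s : E ⊗[F] B) : j a * s = s * j a := by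
    induction s using TensorProduct.induction_on with
    | zero => simp
    | add a b ha hb => rw [mul_add, add_mul, ha, hb]
    | tmul e b => simp [j, ha]
  have hσpow (n : ℕ) (e : E) (b : B) :
      ((σ : E ⊗[F] B →+* E ⊗[F] B) ^ n) (e ⊗ₜ b) = e ⊗ₜ ((η ^ n) b) := by
    induction n generalizing b with
    | zero => rfl
    | succ n ih =>
      rw [pow_succ, pow_succ, RingHom.mul_def, RingHom.comp_apply, AlgEquiv.mul_apply, ← ih]
      simp [σ]
  have D' : SplittingData (σ : E ⊗[F] B →+* E ⊗[F] B) p (j z) (j d) (j d') :=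
    D.map (j : B →+* E ⊗[F] B) (fun s => by simp [σ, j]) (fun i => hcenter _ (D.comm i))
      (fun s => by
        induction s using TensorProduct.induction_on with
        | zero => simp
        | add a b ha hb => rw [map_add, mul_add, add_mul, ha, hb]
        | tmul e b =>
          have := D.twist b
          simp only [RingHom.coe_coe] at this
          simp [j, σ, this])
  refine D'.isSemisimpleRing (ι := (ι : E ⊗[F] B →+* E ⊗[F] A))
    (u := Units.map (j : B →* E ⊗[F] B) u) (Y := 1 ⊗ₜ y) hp ?_ ?_ ?_ ?_ ?_
  · simp [σ, j, hu]
  · intro s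
    induction s using TensorProduct.induction_on with
    | zero => simp
    | add a b ha hb => rw [map_add, mul_add, add_mul, ha, hb]
    | tmul e b =>
      rw [hσpow, hη]
      simp [j]
  · intro s
    induction s using TensorProduct.induction_on with
    | zero => simp
    | add a b ha hb => rw [map_add, map_add, map_add, mul_add, add_mul, ha, hb]
    | tmul e b => simp [ι, σ, hy]
  · simp [ι, j, hyp, TensorProduct.tmul_sub]
  · rw [eq_top_iff]
    intro x _
    induction x using TensorProduct.induction_on with
    | zero => exact zero_mem _
    | add a b ha hb => exact add_mem (ha trivial) (hb trivial)
    | tmul e q =>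
      obtain ⟨a, rfl⟩ := hgen q
      rw [TensorProduct.tmul_sum]
      refine sum_mem fun i _ => ?_
      have : e ⊗ₜ[F] (g (a i) * y ^ (i : ℕ)) = ι (e ⊗ₜ a i) * (1 ⊗ₜ y) ^ (i : ℕ) := by simp [ι]
      rw [this]
      refine mul_mem (Subring.subset_closure (Or.inl ⟨_, rfl⟩)) (pow_mem ?_ _)
      exact Subring.subset_closure (Or.inr rfl)

theorem SplittingData.isSeparableAlgebra (D : SplittingData (η : B →+* B) p z d d')
    (hB : IsSeparableAlgebra F B) (hp : 2 ≤ p) (hu : η u = u)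
    (hη : ∀ b, (η ^ p) b = u * b * (↑u⁻¹ : B)) :
    IsSeparableAlgebra F (SkewQuotient (SkewPoly.relation η p (u : B) (u * d))) := by
  have := hB.1
  have := hB.2
  have hsurj : Function.Surjective
      (SkewPoly.quotientCombination p (SkewPoly.relation η p (u : B) (u * d))) :=
    SkewPoly.quotientCombination_surjective hp
  refine ⟨Module.Finite.of_surjective _ hsurj, ?_⟩
  exact D.isSemisimpleRing_tensorProduct (AlgebraicClosure F) (SkewPoly.quotientMap _)
    (SkewPoly.quotientX _) (by omega) hu hη (SkewPoly.quotientX_mul _) SkewPoly.quotientX_pow_eq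
    fun x => (hsurj x).imp fun a ha => by rw [← ha, SkewPoly.quotientCombination_apply]

end BaseChange

/-! ### Clearing denominators in `t`. -/

section Laurent

variable {k : Type*} [Field k]

/-- The element `t` of the field `k((t))`. -/
def laurentT (k : Type*) [Field k] : LaurentSeries k :=
  algebraMap (PowerSeries k) (LaurentSeries k) PowerSeries.X

theorem laurentT_ne_zero : laurentT k ≠ 0 := by
  rw [laurentT, Ne, FaithfulSMul.algebraMap_eq_zero_iff]
  exact PowerSeries.X_ne_zero

theorem exists_laurentT_pow_smul (B₀ : Type*) [Ring B₀] [Algebra (PowerSeries k) B₀]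
    (x : LaurentSeries k ⊗[PowerSeries k] B₀) :
    ∃ N : ℕ, ∃ b₀ : B₀, laurentT k ^ N • x =
      1 ⊗ₜ[PowerSeries k] ((PowerSeries.X : PowerSeries k) • b₀) := by
  have hmono (M : ℕ) (b : B₀) :
      laurentT k ^ M • ((1 : LaurentSeries k) ⊗ₜ[PowerSeries k] b) =
        1 ⊗ₜ ((PowerSeries.X : PowerSeries k) ^ M • b) := by
    rw [laurentT, ← map_pow, algebraMap_smul, TensorProduct.tmul_smul]
  induction x using TensorProduct.induction_on with
  | zero => exact ⟨0, 0, by simp⟩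
  | add x y hx hy =>
    obtain ⟨M, a, ha⟩ := hx
    obtain ⟨N, b, hb⟩ := hy
    refine ⟨M + N, (PowerSeries.X : PowerSeries k) ^ N • a + (PowerSeries.X : PowerSeries k) ^ M • b,
      ?_⟩
    rw [smul_add, pow_add, mul_smul, mul_smul, smul_comm (laurentT k ^ M) _ x, ha, hb, hmono, hmono,
      ← TensorProduct.tmul_add, smul_add, smul_comm (_ ^ N) PowerSeries.X a,
      smul_comm (_ ^ M) PowerSeries.X b]
  | tmul f b =>
    obtain ⟨⟨g, s⟩, hg⟩ := IsLocalization.surj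
      (Submonoid.powers (PowerSeries.X : PowerSeries k)) f
    obtain ⟨n, hn⟩ := s.2
    -- `n` powers of `t` clear the denominator; one more provides the factor `t`.
    refine ⟨n + 1, g • b, ?_⟩
    have hf : laurentT k ^ (n + 1) * f =
        algebraMap (PowerSeries k) (LaurentSeries k) (PowerSeries.X * g) := by
      rw [map_mul, ← hg, ← hn, map_pow, laurentT]
      ring
    rw [TensorProduct.smul_tmul', smul_eq_mul, hf, ← mul_smul, ← TensorProduct.smul_tmul,
      Algebra.algebraMap_eq_smul_one]

end Laurent

end

/-! ### Assembly of the theorem. -/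

/-- A single `c` serves for all `N`, so the exponent can be chosen afterwards to suit a given
integral form. -/
theorem relation_isSeparable_isFreeOnPowers {k : Type*} [Field k] {B : Type*} [Ring B]
    [Algebra (LaurentSeries k) B] (hB : IsSeparableAlgebra (LaurentSeries k) B)
    (p : ℕ) (hp : p.Prime) (η : B ≃ₐ[LaurentSeries k] B) (u : Bˣ)
    (hηu : η (u : B) = u) (hηp : ∀ b : B, (η ^ p) b = u * b * (↑u⁻¹ : B)) :
    ∃ c : B, ∀ N : ℕ,
      IsSeparableAlgebra (LaurentSeries k)
        (SkewQuotient (SkewPoly.relation η p (u : B) (laurentT k ^ N • c))) ∧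
      IsFreeOnPowers p (SkewPoly.relation η p (u : B) (laurentT k ^ N • c)) := by
  have := hB.1
  have := hB.2
  have : IsSemisimpleRing B :=
    isSemisimpleRing_of_tensorProduct (F := LaurentSeries k)
      (E := AlgebraicClosure (LaurentSeries k))
  obtain ⟨z, d, d', D⟩ := exists_splittingData hp η u hηp
  refine ⟨u * d, fun N => ?_⟩
  have hcomm (a : LaurentSeries k) (b : B) : algebraMap (LaurentSeries k) B a * b =
      b * algebraMap (LaurentSeries k) B a := Algebra.commutes a b
  have D' := D.scale (hcomm (laurentT k ^ N)) (hcomm (laurentT k ^ N)⁻¹)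
    (η.commutes (laurentT k ^ N))
    (by rw [← map_mul, mul_inv_cancel₀ (pow_ne_zero _ laurentT_ne_zero), map_one])
  have hc : laurentT k ^ N • ((u : B) * d) =
      u * (algebraMap (LaurentSeries k) B (laurentT k ^ N) * d) := by
    rw [Algebra.smul_def, ← mul_assoc, hcomm, mul_assoc]
  rw [hc]
  exact ⟨D'.isSeparableAlgebra hB hp.two_le hηu hηp,
    SkewPoly.isFreeOnPowers (D'.isNormal hp.two_le hηu hηp)⟩

theorem coeff_C_mul_X {F B : Type*} [Field F] [Ring B] [Algebra F B] (η : B ≃ₐ[F] B) (c : B)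
    (n : ℕ) : (SkewPolynomial.C (Twisted.of η c) * SkewPolynomial.X : SkewPoly η).coeff n =
      if 1 = n then Twisted.of η c else 0 := by
  rw [SkewPolynomial.C_mul_X_eq_monomial]
  exact SkewPolynomial.coeff_monomial

theorem theoremA {k : Type*} [Field k] {B : Type*} [Ring B] [Algebra (LaurentSeries k) B]
    (hB : IsSeparableAlgebra (LaurentSeries k) B)
    (p : ℕ) (hp : p.Prime) (η : B ≃ₐ[LaurentSeries k] B) (u : Bˣ)
    (hηu : η (u : B) = u) (hηp : ∀ b : B, (η ^ p) b = u * b * (↑u⁻¹ : B)) :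
    (∃ q : SkewPoly η,
      (∀ n : ℕ, 1 < n → q.coeff n = 0) ∧
      IsSeparableAlgebra (LaurentSeries k)
        (SkewQuotient (SkewPolynomial.X ^ p - SkewPolynomial.C (Twisted.of η u) + q)) ∧
      IsFreeOnPowers p (SkewPolynomial.X ^ p - SkewPolynomial.C (Twisted.of η u) + q)) ∧
    (∀ (B₀ : Type*) [Ring B₀] [Algebra (PowerSeries k) B₀]
      (Φ : (LaurentSeries k ⊗[PowerSeries k] B₀) ≃ₐ[LaurentSeries k] B),
      ∃ q : SkewPoly η,
        (∀ n : ℕ, 1 < n → q.coeff n = 0) ∧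
        (∀ n : ℕ, ∃ b₀ : B₀,
          q.coeff n = Twisted.of η (Φ (1 ⊗ₜ[PowerSeries k] ((PowerSeries.X : PowerSeries k) • b₀)))) ∧
        IsSeparableAlgebra (LaurentSeries k)
          (SkewQuotient (SkewPolynomial.X ^ p - SkewPolynomial.C (Twisted.of η u) + q)) ∧
        IsFreeOnPowers p (SkewPolynomial.X ^ p - SkewPolynomial.C (Twisted.of η u) + q)) := by

  obtain ⟨c, hc⟩ := relation_isSeparable_isFreeOnPowers hB p hp η u hηu hηp
  have hdeg (c : B) (n : ℕ) (hn : 1 < n) :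
      (SkewPolynomial.C (Twisted.of η c) * SkewPolynomial.X : SkewPoly η).coeff n = 0 := by
    rw [coeff_C_mul_X, if_neg hn.ne]
  refine ⟨⟨_, hdeg _, hc 0⟩, fun B₀ _ _ Φ => ?_⟩
  -- The form `B₀` enters only here: `N` is chosen so that `t ^ N • c` lies in the image of `t B₀`.
  obtain ⟨N, b₀, hN⟩ := exists_laurentT_pow_smul B₀ (Φ.symm c)
  refine ⟨_, hdeg _, fun n => ?_, hc N⟩
  rw [coeff_C_mul_X]
  split_ifs with hn
  · refine ⟨b₀, congrArg (Twisted.of η) ?_⟩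
    rw [← hN, map_smul Φ, Φ.apply_symm_apply]
  · exact ⟨0, by simp⟩
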